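/- **Theorem 8.1.3.** Let $X = G/H$ be a riemannian homogeneous space: $G$ is a Lie group, $H\subset G$ a closed subgroup, and $X$ carries a $G$-invariant riemannian metric. Let $J^2(X)\to X$ be the bundle of 2-jets of functions, and let $F\subset J^2(X)$ be a subequation which is invariant under the natural action $a\cdot J^2_xf = J^2_{ax}(f\circ a^{-1})$ of $G$ on $J^2(X)$. Let $\Omega\subset\subset X$ be a connected, relatively compact domain with non-empty smooth boundary $\partial\Omega$ which is both strictly $F$-convex and strictly $\widetilde F$-convex. Then existence holds for the Dirichlet problem for $F$-harmonic functions on $\Omega$: for every $\varphi\in C(\partial\Omega)$ there is $u\in C(\overline\Omega)$ which is $F$-harmonic on $\Omega$ and satisfies $u|_{\partial\Omega}=\varphi$. Here the following definitions are used. * A *subequation* is a closed set $F\subset J^2(X)$ with $F+\mathcal P\subset F$ and $F+\mathcal N\subset F$ (fibrewise sums), where $\mathcal P=\{A\in \mathrm{Sym}^2(T^*X): A\ge 0\}$ and $\mathcal N$ is the set of 2-jets of constant functions $\le 0$, and with $F=\overline{\mathrm{Int} F}$, $F_x=\overline{\mathrm{Int} F_x}$ and $\mathrm{Int} F_x=(\mathrm{Int}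 F)_x$ for all $x\in X$ (where $\mathrm{Int} F_x$ is the interior relative to the fibre). Its *dual* is $\widetilde F=-(J^2(X)\setminus \mathrm{Int} F)$. * An upper semicontinuous function $u:\Omega\to[-\infty,\infty)$ is *$F$-subharmonic* if $J^2_x\psi\in F$ whenever $x\in\Omega$ and $\psi$ is a $C^2$ function near $x$ with $u\le\psi$ near $x$ and $u(x)=\psi(x)$. A function $u$ is *$F$-harmonic* if $u$ is $F$-subharmonic and $-u$ is $\widetilde F$-subharmonic. * Write $J^2(X)=\mathbf R\oplus J^2_{\mathrm{red}}(X)$, where $\mathbf R$ records the value of the function, and for $\lambda\in\mathbf R$ let $F_\lambda=\{J\in J^2_{\mathrm{red}}(X): (\lambda,J)\in F\}$. The *asymptotic interior* $\overrightarrow{F_\lambda}$ is the set of $J\in J^2_{\mathrm{red}}(X)$ having a neighbourhood $N$ in the total space $J^2_{\mathrm{red}}(X)$ and a number $t_0>0$ with $t\cdot N\subset F_\lambda$ for all $t\ge t_0$. * $\partial\Omega$ is *strictly $F$-convex* if for every $x\in\partial\Omega$ and every $\lambda\in\mathbf R$ there is a smooth function $\rho$ on a neighbourhood $U$ of $x$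 with $\{\rho=0\}=\partial\Omega\cap U$, $d\rho\neq0$ on $\partial\Omega\cap U$, $\rho<0$ on $\Omega\cap U$, and $J^2_{\mathrm{red},z}\,\rho\in\overrightarrow{F_\lambda}$ for all $z\in U$. -/

import Mathlib

open Set Filter Topology
open scoped Manifold ContDiff

noncomputable section

namespace JetDirichlet

/-- `Sym²(E*)`: symmetric bilinear forms on `E`. -/
def SymForm (E : Type*) [NormedAddCommGroup E] [NormedSpace ℝ E] :
    @Submodule ℝ (E →L[ℝ] E →L[ℝ] ℝ) _
      SeminormedAddCommGroup.toAddCommGroup.toAddCommMonoid NormedSpace.toModule where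
  carrier := {B | ∀ v w, B v w = B w v}
  add_mem' hA hB v w := congrArg₂ (· + ·) (hA v w) (hB v w)
  zero_mem' _ _ := rfl
  smul_mem' c _ hA v w := congrArg (c * ·) (hA v w)

section Model

variable (E : Type*) [NormedAddCommGroup E] [NormedSpace ℝ E]

instance : NormedAddCommGroup (SymForm E) := inferInstance

instance : NormedSpace ℝ (SymForm E) := inferInstance

variable {E} in
/-- The symmetric part of a bilinear form. It is only applied to second derivatives, which are
already symmetric for `C²` functions; it serves to land in `SymForm` without a side condition. -/
def symPart (B : E →L[ℝ] E →L[ℝ] ℝ) : SymForm E :=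
  ⟨(1 / 2 : ℝ) • (B + B.flip), fun v w =>
    congrArg ((1 / 2 : ℝ) * ·) (add_comm (B v w) (B w v))⟩

/-- The reduced 2-jets `(p, A)` in coordinates. -/
abbrev RedFibre : Type _ := (E →L[ℝ] ℝ) × SymForm E

/-- The 2-jets `(r, (p, A))` in coordinates. -/
abbrev JetFibre : Type _ := ℝ × RedFibre E

/-- The total space of the bundle `J²(X)` of 2-jets of functions on a manifold `X` modelled on `E`.
As for Mathlib's `TangentSpace`, an element of the fibre over `x` is recorded by its coordinates
`(r, p, A)` in the preferred chart at `x`. -/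
@[ext] structure Jet2 (X : Type*) where
  base : X
  val : JetFibre E

/-- The total space of the bundle of reduced 2-jets, `J²(X) = ℝ ⊕ J²_red(X)`. -/
@[ext] structure RedJet2 (X : Type*) where
  base : X
  val : RedFibre E

variable {E} {X : Type*}

/-- The reduced jet `j` together with the value `r`, for the splitting `J²(X) = ℝ ⊕ J²_red(X)`. -/
def RedJet2.withValue (r : ℝ) (j : RedJet2 E X) : Jet2 E X :=
  ⟨j.base, (r, j.val)⟩

/-- Fibrewise scalar multiplication. -/
def RedJet2.scale (t : ℝ) (j : RedJet2 E X) : RedJet2 E X :=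
  ⟨j.base, t • j.val⟩

/-- Fibrewise negation. -/
def Jet2.neg (j : Jet2 E X) : Jet2 E X :=
  ⟨j.base, -j.val⟩

/-- The fibre `F_x` of a subset `F` of the jet bundle. -/
def fibre (F : Set (Jet2 E X)) (x : X) : Set (JetFibre E) :=
  {v | (⟨x, v⟩ : Jet2 E X) ∈ F}

end Model

section Manifold

variable {E : Type*} [NormedAddCommGroup E] [NormedSpace ℝ E]
  {X : Type*} [TopologicalSpace X] [ChartedSpace E X]

/-- Value, first and second derivative of `f` at `x`, computed in the preferred chart at `c`. -/
def jetInChart (c : X) (f : X → ℝ) (x : X) : JetFibre E :=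
  let h : E → ℝ := fun y => f ((extChartAt 𝓘(ℝ, E) c).symm y)
  let y : E := extChartAt 𝓘(ℝ, E) c x
  (f x, fderiv ℝ h y, symPart (fderiv ℝ (fderiv ℝ h) y))

/-- The 2-jet `J²_x f`. -/
def jet2 (f : X → ℝ) (x : X) : Jet2 E X := ⟨x, jetInChart x f x⟩

/-- The reduced 2-jet `J²_{red,x} f`. -/
def redJet2 (f : X → ℝ) (x : X) : RedJet2 E X := ⟨x, (jetInChart x f x).2⟩

/-- A function, smooth near `j.base`, whose 2-jet at `j.base` is `j`: the quadratic Taylor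
polynomial in the preferred chart at `j.base`. -/
def Jet2.rep (j : Jet2 E X) (z : X) : ℝ :=
  let w : E := extChartAt 𝓘(ℝ, E) j.base z - extChartAt 𝓘(ℝ, E) j.base j.base
  j.val.1 + j.val.2.1 w + (1 / 2 : ℝ) * (j.val.2.2 : E →L[ℝ] E →L[ℝ] ℝ) w w

/-- The coordinates of a 2-jet induced by the preferred chart at `c`; meaningful when `j.base`
lies in the domain of that chart. -/
def Jet2.coord (c : X) (j : Jet2 E X) : E × JetFibre E :=
  (extChartAt 𝓘(ℝ, E) c j.base, jetInChart c j.rep j.base)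

/-- The topology of the total space of `J²(X)`: the sets that are open in the coordinates induced
by some chart generate it. -/
instance : TopologicalSpace (Jet2 E X) :=
  TopologicalSpace.generateFrom
    {U | ∃ (c : X) (V : Set (E × JetFibre E)), IsOpen V ∧
      U = {j | j.base ∈ (chartAt E c).source ∧ j.coord c ∈ V}}

/-- The topology of the total space of `J²_red(X)`, as the subbundle of jets with value `0`. -/
instance : TopologicalSpace (RedJet2 E X) :=
  TopologicalSpace.induced (RedJet2.withValue 0) inferInstance

/-- A subequation on `X`: a closed subset of `J²(X)` with the positivity, negativity and
topological conditions. -/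
structure IsSubequation (F : Set (Jet2 E X)) : Prop where
  isClosed : IsClosed F
  positivity : ∀ (x : X) (r : ℝ) (p : E →L[ℝ] ℝ) (A P : SymForm E),
    (∀ v, 0 ≤ (P : E →L[ℝ] E →L[ℝ] ℝ) v v) →
    (⟨x, (r, p, A)⟩ : Jet2 E X) ∈ F → (⟨x, (r, p, A + P)⟩ : Jet2 E X) ∈ F
  negativity : ∀ (x : X) (r s : ℝ) (q : RedFibre E), s ≤ 0 →
    (⟨x, (r, q)⟩ : Jet2 E X) ∈ F → (⟨x, (r + s, q)⟩ : Jet2 E X) ∈ F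
  eq_closure_interior : F = closure (interior F)
  fibre_eq_closure_interior : ∀ x, fibre F x = closure (interior (fibre F x))
  interior_fibre : ∀ x, interior (fibre F x) = fibre (interior F) x

/-- The dual subequation `F̃ = -(∼ Int F)`. -/
def dual (F : Set (Jet2 E X)) : Set (Jet2 E X) := {j | j.neg ∉ interior F}

/-- `u` is `F`-subharmonic on the open set `Ω`: it is upper semicontinuous with values in
`[-∞, ∞)`, and the 2-jet at `x ∈ Ω` of every `C²` test function for `u` at `x` lies in `F`. -/
def IsSubharmonicOn (F : Set (Jet2 E X)) (Ω : Set X) (u : X → EReal) : Prop :=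
  UpperSemicontinuousOn u Ω ∧ (∀ x ∈ Ω, u x < ⊤) ∧
    ∀ x ∈ Ω, ∀ φ : X → ℝ, ContMDiffAt 𝓘(ℝ, E) 𝓘(ℝ, ℝ) 2 φ x →
      (∀ᶠ z in 𝓝 x, u z ≤ (φ z : EReal)) → u x = (φ x : EReal) → jet2 φ x ∈ F

/-- `u` is `F`-harmonic on `Ω`: `u` is `F`-subharmonic and `-u` is `F̃`-subharmonic there. -/
def IsHarmonicOn (F : Set (Jet2 E X)) (Ω : Set X) (u : X → ℝ) : Prop :=
  IsSubharmonicOn F Ω (fun x => (u x : EReal)) ∧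
    IsSubharmonicOn (dual F) Ω (fun x => ((-u x : ℝ) : EReal))

/-- The reduced subequation `F_l`, obtained by fixing the value of the function to be `l`. -/
def fixValue (F : Set (Jet2 E X)) (l : ℝ) : Set (RedJet2 E X) := {j | j.withValue l ∈ F}

/-- The asymptotic interior of a subset of `J²_red(X)`. -/
def asymptoticInterior (F : Set (RedJet2 E X)) : Set (RedJet2 E X) :=
  {J | ∃ N ∈ 𝓝 J, ∃ t₀ : ℝ, 0 < t₀ ∧ ∀ t ≥ t₀, ∀ J' ∈ N, J'.scale t ∈ F}

/-- `ρ` is a smooth defining function for `∂Ω` on the open set `U`. -/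
structure IsDefiningFunctionOn (Ω U : Set X) (ρ : X → ℝ) : Prop where
  smooth : ContMDiffOn 𝓘(ℝ, E) 𝓘(ℝ, ℝ) ∞ ρ U
  zero_iff : ∀ z ∈ U, ρ z = 0 ↔ z ∈ frontier Ω
  deriv_ne_zero : ∀ z ∈ U, z ∈ frontier Ω → mfderiv 𝓘(ℝ, E) 𝓘(ℝ, ℝ) ρ z ≠ 0
  neg : ∀ z ∈ U, z ∈ Ω → ρ z < 0

/-- `∂Ω` is strictly `F`-convex at `x`, for a reduced subequation `F`: near `x` there is a
defining function whose reduced 2-jets lie in the asymptotic interior of `F`. -/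
def RedStrictlyConvexAt (F : Set (RedJet2 E X)) (Ω : Set X) (x : X) : Prop :=
  ∃ (U : Set X) (ρ : X → ℝ), IsOpen U ∧ x ∈ U ∧ IsDefiningFunctionOn (E := E) Ω U ρ ∧
    ∀ z ∈ U, redJet2 ρ z ∈ asymptoticInterior F

/-- `∂Ω` is strictly `F`-convex: at each of its points it is strictly `F_l`-convex for every real
value `l`. In particular `∂Ω` is then smooth, with `Ω` locally on one side. -/
def HasStrictlyConvexBoundary (F : Set (Jet2 E X)) (Ω : Set X) : Prop :=
  ∀ x ∈ frontier Ω, ∀ l : ℝ, RedStrictlyConvexAt (fixValue F l) Ω x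

/-- Existence holds for the Dirichlet problem for `F`-harmonic functions on `Ω`. -/
def DirichletExistence (F : Set (Jet2 E X)) (Ω : Set X) : Prop :=
  ∀ φ : X → ℝ, ContinuousOn φ (frontier Ω) →
    ∃ u : X → ℝ, ContinuousOn u (closure Ω) ∧ IsHarmonicOn F Ω u ∧ ∀ x ∈ frontier Ω, u x = φ x

/-- `F ⊆ J²(X)` is invariant under the natural action `a • J²_x f = J²_{a • x} (f ∘ a⁻¹)`. -/
def IsJetInvariant (G : Type*) [Group G] [MulAction G X] (F : Set (Jet2 E X)) : Prop :=
  ∀ (a : G) (x : X) (f : X → ℝ), ContMDiffAt 𝓘(ℝ, E) 𝓘(ℝ, ℝ) 2 f x →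
    jet2 f x ∈ F → jet2 (fun z => f (a⁻¹ • z)) (a • x) ∈ F

/-- Smooth riemannian metrics on `X`. -/
abbrev SmoothMetric (E : Type*) [NormedAddCommGroup E] [NormedSpace ℝ E]
    (X : Type*) [TopologicalSpace X] [ChartedSpace E X] [IsManifold 𝓘(ℝ, E) ∞ X] : Type _ :=
  Bundle.ContMDiffRiemannianMetric 𝓘(ℝ, E) ∞ E (fun x : X => TangentSpace 𝓘(ℝ, E) x)

/-- The group `G` acts on `X` by isometries of the riemannian metric `g`. -/
def IsMetricInvariant (G : Type*) [Group G] [MulAction G X] [IsManifold 𝓘(ℝ, E) ∞ X]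
    (g : SmoothMetric E X) : Prop :=
  ∀ (a : G) (x : X) (v w : TangentSpace 𝓘(ℝ, E) x),
    g.inner (a • x) (mfderiv 𝓘(ℝ, E) 𝓘(ℝ, E) (fun z : X => a • z) x v)
      (mfderiv 𝓘(ℝ, E) 𝓘(ℝ, E) (fun z : X => a • z) x w) = g.inner x v w

end Manifold

end JetDirichlet

end

/-!
Strict convexity of the boundary provides, at each boundary point `x` and for each value `l`, a
barrier: a function `h` near `x` with a strict maximum over the closure of `Ω` at `x`, such that all
large multiples of its reduced jet lie in the interior of `F_l`.

For a priori bounds, rescale functions of unbounded maxima to maximum `1`. Barriers for the dual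
keep the set where these functions asymptotically attain their maximum away from the boundary. But
`F` is invariant, so the same holds for their translates by the group, and if that set were nonempty
some translate of it would touch the boundary from inside.

The Perron function, formed from subharmonic functions truncated below, then exists; the barriers
of `F̃` bound it from above and those of `F` from below near the boundary, so it attains the
boundary values continuously. Replacing it by its maximum with a small translate, lowered by `ε`,
gives a competitor again, whence its modulus of continuity in the interior is controlled by the one
at the boundary. This uses no comparison principle. Where its negative fails to be
`F̃`-subharmonic, a bump would produce a larger competitor. Finally, the a priori bound for
`F̃` shows that the truncation is never active.
-/

noncomputable section

namespace JetDirichlet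

/-! ### Second derivatives and jets in charts -/

section SecondOrder

variable {E : Type*} [NormedAddCommGroup E] [NormedSpace ℝ E]

theorem fderiv_fderiv_comp_eq_zero {E' F : Type*} [NormedAddCommGroup E'] [NormedSpace ℝ E']
    [NormedAddCommGroup F] [NormedSpace ℝ F] {h : E → F} {τ : E' → E} {e : E'}
    (hh : ContDiffAt ℝ 2 h (τ e)) (hτ : ContDiffAt ℝ 2 τ e)
    (h1 : fderiv ℝ h (τ e) = 0) (h2 : fderiv ℝ (fderiv ℝ h) (τ e) = 0) :
    fderiv ℝ (fderiv ℝ (h ∘ τ)) e = 0 := by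
  have chain_rule : fderiv ℝ (h ∘ τ) =ᶠ[𝓝 e] fun y => (fderiv ℝ h (τ y)).comp (fderiv ℝ τ y) := by
    filter_upwards [hτ.continuousAt.eventually (hh.eventually (by simp)),
      hτ.eventually (by simp)] with y hhy hτy
    exact fderiv_comp y (hhy.differentiableAt (by simp)) (hτy.differentiableAt (by simp))
  have dh : HasFDerivAt (fun y => fderiv ℝ h (τ y)) (0 : E' →L[ℝ] E →L[ℝ] F) e := by
    have := ((hh.fderiv_right (m := 1) (by norm_num)).differentiableAt (by simp)).hasFDerivAt.comp e
      (hτ.differentiableAt (by simp)).hasFDerivAt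
    rwa [h2, ContinuousLinearMap.zero_comp] at this
  have dτ : HasFDerivAt (fderiv ℝ τ) (fderiv ℝ (fderiv ℝ τ) e) e :=
    ((hτ.fderiv_right (m := 1) (by norm_num)).differentiableAt (by simp)).hasFDerivAt
  rw [chain_rule.fderiv_eq, (dh.clm_comp dτ).fderiv]
  ext v w
  simp [h1]

theorem deriv_deriv_nonneg_of_isLocalMin {f : ℝ → ℝ} {x : ℝ} (hc : ContinuousAt f x)
    (hmin : IsLocalMin f x) : 0 ≤ deriv (deriv f) x := by
  by_contra! hneg
  have hmax := isLocalMax_of_deriv_deriv_neg hneg hmin.deriv_eq_zero hc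
  have hconst : f =ᶠ[𝓝 x] fun _ => f x := by
    filter_upwards [hmin, hmax] with t h1 h2
    exact le_antisymm h2 h1
  rw [hconst.deriv.deriv_eq] at hneg
  simp at hneg

theorem deriv_deriv_comp_of_hasDerivAt_const {h : E → ℝ} {γ : ℝ → E} {v : E} {t : ℝ}
    (hγ : ∀ s, HasDerivAt γ v s) (hh : ContDiffAt ℝ 2 h (γ t)) :
    deriv (deriv (h ∘ γ)) t = fderiv ℝ (fderiv ℝ h) (γ t) v v := by
  have hderiv : deriv (h ∘ γ) =ᶠ[𝓝 t] fun s => fderiv ℝ h (γ s) v := by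
    filter_upwards [(hγ t).continuousAt.eventually (hh.eventually (by simp))] with s hs
    exact ((hs.differentiableAt (by simp)).hasFDerivAt.comp_hasDerivAt s (hγ s)).deriv
  have hdiff : DifferentiableAt ℝ (fderiv ℝ h) (γ t) :=
    (hh.fderiv_right (m := 1) (by norm_num)).differentiableAt (by simp)
  have hsecond := (hdiff.hasFDerivAt.comp_hasDerivAt t (hγ t)).clm_apply (hasDerivAt_const t v)
  rw [hderiv.deriv_eq]
  simpa using hsecond.deriv

theorem fderiv_fderiv_nonneg_of_isLocalMin {h : E → ℝ} {e : E} (hh : ContDiffAt ℝ 2 h e)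
    (hmin : IsLocalMin h e) (v : E) : 0 ≤ fderiv ℝ (fderiv ℝ h) e v v := by
  obtain ⟨γ, hγ, rfl⟩ : ∃ γ : ℝ → E, (∀ s, HasDerivAt γ v s) ∧ γ 0 = e :=
    ⟨fun s => e + s • v, fun s => by simpa using ((hasDerivAt_id s).smul_const v).const_add e,
      by simp⟩
  rw [← deriv_deriv_comp_of_hasDerivAt_const hγ hh]
  exact deriv_deriv_nonneg_of_isLocalMin (hh.continuousAt.comp (hγ 0).continuousAt)
    (hmin.comp_tendsto (hγ 0).continuousAt)

theorem symPart_add (B C : E →L[ℝ] E →L[ℝ] ℝ) : symPart (B + C) = symPart B + symPart C := by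
  apply Subtype.ext
  ext v w
  simp [symPart]
  ring

theorem symPart_smul (s : ℝ) (B : E →L[ℝ] E →L[ℝ] ℝ) : symPart (s • B) = s • symPart B := by
  apply Subtype.ext
  ext v w
  simp [symPart]
  ring

theorem symPart_zero : symPart (0 : E →L[ℝ] E →L[ℝ] ℝ) = 0 := by
  apply Subtype.ext
  ext
  simp [symPart]

theorem continuous_symPart : Continuous (symPart : (E →L[ℝ] E →L[ℝ] ℝ) → SymForm E) :=
  ((continuous_id.add (ContinuousLinearMap.flipₗᵢ ℝ E E ℝ).continuous).const_smul
    (1 / 2 : ℝ)).subtype_mk _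

theorem coe_symPart_of_isSymm {B : E →L[ℝ] E →L[ℝ] ℝ} (hB : ∀ v w, B v w = B w v) :
    (symPart B : E →L[ℝ] E →L[ℝ] ℝ) = B := by
  ext v w
  simp [symPart, hB w v]
  ring

theorem symPart_coe (A : SymForm E) : symPart (A : E →L[ℝ] E →L[ℝ] ℝ) = A :=
  Subtype.ext (coe_symPart_of_isSymm A.2)

theorem fderiv_quadratic (r : ℝ) (p : E →L[ℝ] ℝ) (A : SymForm E) (e : E) :
    fderiv ℝ (fun y => r + p (y - e) + (1 / 2 : ℝ) * (A : E →L[ℝ] E →L[ℝ] ℝ) (y - e) (y - e)) =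
      fun y => p + (A : E →L[ℝ] E →L[ℝ] ℝ) (y - e) := by
  ext y v
  have hsub : HasFDerivAt (fun y : E => y - e) (ContinuousLinearMap.id ℝ E) y :=
    (hasFDerivAt_id y).sub_const e
  have hA : HasFDerivAt (fun y : E => (A : E →L[ℝ] E →L[ℝ] ℝ) (y - e))
      ((A : E →L[ℝ] E →L[ℝ] ℝ).comp (ContinuousLinearMap.id ℝ E)) y :=
    (A : E →L[ℝ] E →L[ℝ] ℝ).hasFDerivAt.comp y hsub
  have hsum := (((p.hasFDerivAt.comp y hsub).const_add r).add
    ((hA.clm_apply hsub).const_mul (1 / 2 : ℝ))).fderiv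
  simp only [Function.comp_def, Pi.add_def] at hsum
  have hsymm := A.2 (y - e) v
  rw [hsum]
  simp only [_root_.add_apply, _root_.smul_apply, smul_eq_mul,
    ContinuousLinearMap.comp_apply, ContinuousLinearMap.flip_apply,
    ContinuousLinearMap.id_apply]
  linarith

theorem contDiff_quadratic {n : WithTop ℕ∞} (r : ℝ) (p : E →L[ℝ] ℝ) (A : SymForm E) (e : E) :
    ContDiff ℝ n
      (fun y => r + p (y - e) + (1 / 2 : ℝ) * (A : E →L[ℝ] E →L[ℝ] ℝ) (y - e) (y - e)) := by
  fun_prop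

end SecondOrder

section Charts

variable {E : Type*} [NormedAddCommGroup E] [NormedSpace ℝ E]
  {X : Type*} [TopologicalSpace X] [ChartedSpace E X]

/-- The expression of `f` in the preferred chart at `c`, the function which `jetInChart`
differentiates. -/
def inChart (c : X) (f : X → ℝ) (y : E) : ℝ := f ((extChartAt 𝓘(ℝ, E) c).symm y)

theorem jetInChart_eq (c : X) (f : X → ℝ) (x : X) :
    jetInChart (E := E) c f x = (f x, fderiv ℝ (inChart c f) (extChartAt 𝓘(ℝ, E) c x),
      symPart (fderiv ℝ (fderiv ℝ (inChart c f)) (extChartAt 𝓘(ℝ, E) c x))) := rfl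

theorem jetInChart_const (c : X) (r : ℝ) (x : X) :
    jetInChart (E := E) c (fun _ => r) x = (r, 0) := by
  have hconst : inChart (E := E) c (fun _ : X => r) = fun _ => r := rfl
  have hderiv : fderiv ℝ (fun _ : E => r) = fun _ => 0 := by ext; simp
  rw [jetInChart_eq, hconst, hderiv]
  simp only [fderiv_fun_const, Pi.zero_apply]
  rw [symPart_zero]
  rfl

theorem Jet2.rep_base (j : Jet2 E X) : j.rep j.base = j.val.1 := by
  simp [Jet2.rep]

theorem Jet2.jetInChart_rep (j : Jet2 E X) : jetInChart j.base j.rep j.base = j.val := by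
  set χ := extChartAt 𝓘(ℝ, E) j.base with hχ
  have hquad : inChart (E := E) j.base j.rep =ᶠ[𝓝 (χ j.base)] fun y => j.val.1 +
      j.val.2.1 (y - χ j.base) + (1 / 2 : ℝ) *
        (j.val.2.2 : E →L[ℝ] E →L[ℝ] ℝ) (y - χ j.base) (y - χ j.base) := by
    filter_upwards [extChartAt_target_mem_nhds (I := 𝓘(ℝ, E)) j.base] with y hy
    simp only [inChart, Jet2.rep]
    rw [← hχ, χ.right_inv hy]
  have hderiv := hquad.fderiv (𝕜 := ℝ)
  rw [fderiv_quadratic] at hderiv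
  have hderiv2 : fderiv ℝ (fun y => j.val.2.1 + (j.val.2.2 : E →L[ℝ] E →L[ℝ] ℝ) (y - χ j.base))
      (χ j.base) = j.val.2.2 := by
    have hsub : HasFDerivAt (fun y : E => y - χ j.base) (ContinuousLinearMap.id ℝ E) (χ j.base) :=
      (hasFDerivAt_id _).sub_const _
    have := (((j.val.2.2 : E →L[ℝ] E →L[ℝ] ℝ).hasFDerivAt.comp (χ j.base) hsub).const_add
      j.val.2.1).fderiv
    simpa [Function.comp_def] using this
  rw [jetInChart_eq, hderiv.fderiv_eq, hderiv.eq_of_nhds, hderiv2, symPart_coe, j.rep_base]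
  simp

theorem jet2_rep (j : Jet2 E X) : jet2 j.rep j.base = j :=
  Jet2.ext rfl j.jetInChart_rep

theorem Jet2.contMDiffAt_rep (j : Jet2 E X) :
    ContMDiffAt 𝓘(ℝ, E) 𝓘(ℝ, ℝ) 2 j.rep j.base := by
  have hχ : ContMDiffAt 𝓘(ℝ, E) 𝓘(ℝ, E) 2 (extChartAt 𝓘(ℝ, E) j.base) j.base :=
    contMDiffAt_extChartAt
  exact (contDiff_quadratic j.val.1 j.val.2.1 j.val.2.2
    (extChartAt 𝓘(ℝ, E) j.base j.base)).contMDiff.contMDiffAt.comp j.base hχ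

theorem inChart_comp_eventuallyEq {Y : Type*} [TopologicalSpace Y] [ChartedSpace E Y]
    {c : X} {c' : Y} {Φ : Y → X} {z : Y} (f : X → ℝ) (hΦ : ContinuousAt Φ z)
    (hc : Φ z ∈ (chartAt E c).source) (hc' : z ∈ (chartAt E c').source) :
    inChart (E := E) c' (f ∘ Φ) =ᶠ[𝓝 (extChartAt 𝓘(ℝ, E) c' z)]
      inChart c f ∘ extChartAt 𝓘(ℝ, E) c ∘ Φ ∘ (extChartAt 𝓘(ℝ, E) c').symm := by
  have hz : (extChartAt 𝓘(ℝ, E) c').symm (extChartAt 𝓘(ℝ, E) c' z) = z :=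
    (extChartAt 𝓘(ℝ, E) c').left_inv (by simpa using hc')
  have hcont : ContinuousAt (Φ ∘ (extChartAt 𝓘(ℝ, E) c').symm) (extChartAt 𝓘(ℝ, E) c' z) :=
    hΦ.comp_of_eq (continuousAt_extChartAt_symm' (by simpa using hc')) hz
  filter_upwards [hcont.preimage_mem_nhds (t := (chartAt E c).source)
    (by simpa only [Function.comp_apply, hz] using (chartAt E c).open_source.mem_nhds hc)] with y hy
  have hinv := (extChartAt 𝓘(ℝ, E) c).left_inv (x := Φ ((extChartAt 𝓘(ℝ, E) c').symm y))
    (by simpa using hy)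
  simp only [inChart, Function.comp_apply, hinv]

variable [IsManifold 𝓘(ℝ, E) 2 X]

theorem contDiffAt_inChart {c : X} {f : X → ℝ} {x : X} (hx : x ∈ (chartAt E c).source)
    (hf : ContMDiffAt 𝓘(ℝ, E) 𝓘(ℝ, ℝ) 2 f x) :
    ContDiffAt ℝ 2 (inChart (E := E) c f) (extChartAt 𝓘(ℝ, E) c x) := by
  have := (contMDiffAt_iff_source_of_mem_source (I := 𝓘(ℝ, E)) (I' := 𝓘(ℝ, ℝ)) (n := 2)
    (x := c) (x' := x) (f := f) hx).1 hf
  rwa [modelWithCornersSelf_coe, range_id, contMDiffWithinAt_univ,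
    contMDiffAt_iff_contDiffAt] at this

theorem contDiffAt_extChartAt_comp {Y : Type*} [TopologicalSpace Y] [ChartedSpace E Y]
    [IsManifold 𝓘(ℝ, E) 2 Y] {c : X} {c' : Y} {Φ : Y → X} {z : Y}
    (hΦ : ContMDiffAt 𝓘(ℝ, E) 𝓘(ℝ, E) 2 Φ z)
    (hc : Φ z ∈ (chartAt E c).source) (hc' : z ∈ (chartAt E c').source) :
    ContDiffAt ℝ 2 (extChartAt 𝓘(ℝ, E) c ∘ Φ ∘ (extChartAt 𝓘(ℝ, E) c').symm)
      (extChartAt 𝓘(ℝ, E) c' z) := by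
  have hz : (extChartAt 𝓘(ℝ, E) c').symm (extChartAt 𝓘(ℝ, E) c' z) = z :=
    (extChartAt 𝓘(ℝ, E) c').left_inv (by simpa using hc')
  have hΦ' := (contMDiffAt_iff_source_of_mem_source (I := 𝓘(ℝ, E)) (I' := 𝓘(ℝ, E)) (n := 2)
    (x := c') (x' := z) (f := Φ) hc').1 hΦ
  rw [modelWithCornersSelf_coe, range_id, contMDiffWithinAt_univ] at hΦ'
  have hχ : ContMDiffAt 𝓘(ℝ, E) 𝓘(ℝ, E) 2 (extChartAt 𝓘(ℝ, E) c) (Φ z) :=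
    contMDiffAt_extChartAt' hc
  exact contMDiffAt_iff_contDiffAt.1 (hχ.comp_of_eq hΦ' (congrArg Φ hz))

theorem eventually_contMDiffAt_two {f : X → ℝ} {x : X}
    (hf : ContMDiffAt 𝓘(ℝ, E) 𝓘(ℝ, ℝ) 2 f x) :
    ∀ᶠ z in 𝓝 x, ContMDiffAt 𝓘(ℝ, E) 𝓘(ℝ, ℝ) 2 f z :=
  (contMDiffAt_iff_contMDiffAt_nhds (by decide)).1 hf

theorem coe_jetInChart_snd_snd {c : X} {f : X → ℝ} {x : X} (hx : x ∈ (chartAt E c).source)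
    (hf : ContMDiffAt 𝓘(ℝ, E) 𝓘(ℝ, ℝ) 2 f x) :
    ((jetInChart (E := E) c f x).2.2 : E →L[ℝ] E →L[ℝ] ℝ) =
      fderiv ℝ (fderiv ℝ (inChart (E := E) c f)) (extChartAt 𝓘(ℝ, E) c x) :=
  coe_symPart_of_isSymm ((contDiffAt_inChart hx hf).isSymmSndFDerivAt (by simp))

theorem jetInChart_add_smul {c : X} {f g : X → ℝ} {x : X} (s : ℝ)
    (hx : x ∈ (chartAt E c).source)
    (hf : ContMDiffAt 𝓘(ℝ, E) 𝓘(ℝ, ℝ) 2 f x) (hg : ContMDiffAt 𝓘(ℝ, E) 𝓘(ℝ, ℝ) 2 g x) :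
    jetInChart (E := E) c (fun z => f z + s * g z) x =
      jetInChart c f x + s • jetInChart c g x := by
  have cf := contDiffAt_inChart hx hf
  have cg := contDiffAt_inChart hx hg
  have hderiv : fderiv ℝ (inChart (E := E) c (fun z => f z + s * g z))
      =ᶠ[𝓝 (extChartAt 𝓘(ℝ, E) c x)]
      fderiv ℝ (inChart c f) + s • fderiv ℝ (inChart c g) := by
    filter_upwards [cf.eventually (by simp), cg.eventually (by simp)] with y hfy hgy
    exact ((hfy.differentiableAt (by simp)).hasFDerivAt.add
      ((hgy.differentiableAt (by simp)).hasFDerivAt.const_smul s)).fderiv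
  have df := (cf.fderiv_right (m := 1) (by norm_num)).differentiableAt (by simp)
  have dg := (cg.fderiv_right (m := 1) (by norm_num)).differentiableAt (by simp)
  have hderiv2 := (df.hasFDerivAt.add (dg.hasFDerivAt.const_smul s)).fderiv
  simp only [jetInChart_eq]
  rw [hderiv.fderiv_eq, hderiv.eq_of_nhds, hderiv2, symPart_add, symPart_smul]
  rfl

theorem jetInChart_sub {c : X} {f g : X → ℝ} {x : X} (hx : x ∈ (chartAt E c).source)
    (hf : ContMDiffAt 𝓘(ℝ, E) 𝓘(ℝ, ℝ) 2 f x) (hg : ContMDiffAt 𝓘(ℝ, E) 𝓘(ℝ, ℝ) 2 g x) :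
    jetInChart (E := E) c (fun z => f z - g z) x = jetInChart c f x - jetInChart c g x := by
  have h := jetInChart_add_smul (-1) hx hf hg
  simp only [neg_one_mul, ← sub_eq_add_neg] at h
  exact h.trans ((congrArg (_ + ·) (neg_one_smul ℝ _)).trans (sub_eq_add_neg _ _).symm)

theorem jetInChart_const_add {c : X} {f : X → ℝ} {x : X} (r : ℝ) (hx : x ∈ (chartAt E c).source)
    (hf : ContMDiffAt 𝓘(ℝ, E) 𝓘(ℝ, ℝ) 2 f x) :
    jetInChart (E := E) c (fun z => r + f z) x = (r, 0) + jetInChart c f x := by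
  have h := jetInChart_add_smul 1 hx (contMDiffAt_const (c := r)) hf
  simp only [one_mul, jetInChart_const] at h
  exact h.trans (congrArg (_ + ·) (one_smul ℝ _))

theorem jetInChart_const_add_mul {c : X} {f : X → ℝ} {x : X} (r s : ℝ)
    (hx : x ∈ (chartAt E c).source) (hf : ContMDiffAt 𝓘(ℝ, E) 𝓘(ℝ, ℝ) 2 f x) :
    jetInChart (E := E) c (fun z => r + s * f z) x =
      (r + s * f x, s • (jetInChart c f x).2) := by
  rw [jetInChart_add_smul s hx contMDiffAt_const hf, jetInChart_const]
  exact Prod.ext rfl (zero_add _)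

theorem continuousAt_jetInChart {c : X} {f : X → ℝ} {x : X} (hx : x ∈ (chartAt E c).source)
    (hf : ContMDiffAt 𝓘(ℝ, E) 𝓘(ℝ, ℝ) 2 f x) : ContinuousAt (jetInChart (E := E) c f) x := by
  have hχ : ContinuousAt (extChartAt 𝓘(ℝ, E) c) x := continuousAt_extChartAt' (by simpa using hx)
  have d1 := (contDiffAt_inChart hx hf).fderiv_right (m := 1) (by norm_num)
  have d2 := d1.fderiv_right (m := 0) (by norm_num)
  exact hf.continuousAt.prodMk ((ContinuousAt.comp d1.continuousAt hχ).prodMk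
    (continuous_symPart.continuousAt.comp (ContinuousAt.comp d2.continuousAt hχ)))

theorem jetInChart_comp_snd_eq_zero {Y : Type*} [TopologicalSpace Y] [ChartedSpace E Y]
    [IsManifold 𝓘(ℝ, E) 2 Y] {c : X} {c' : Y} {Φ : Y → X} {f : X → ℝ} {z : Y}
    (hΦ : ContMDiffAt 𝓘(ℝ, E) 𝓘(ℝ, E) 2 Φ z) (hf : ContMDiffAt 𝓘(ℝ, E) 𝓘(ℝ, ℝ) 2 f (Φ z))
    (hc : Φ z ∈ (chartAt E c).source) (hc' : z ∈ (chartAt E c').source)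
    (h0 : (jetInChart (E := E) c f (Φ z)).2 = 0) :
    (jetInChart (E := E) c' (f ∘ Φ) z).2 = 0 := by
  set τ : E → E := extChartAt 𝓘(ℝ, E) c ∘ Φ ∘ (extChartAt 𝓘(ℝ, E) c').symm with hτ_def
  have hτ := contDiffAt_extChartAt_comp hΦ hc hc'
  have hτz : τ (extChartAt 𝓘(ℝ, E) c' z) = extChartAt 𝓘(ℝ, E) c (Φ z) := by
    simp only [hτ_def, Function.comp_apply,
      (extChartAt 𝓘(ℝ, E) c').left_inv (x := z) (by simpa using hc')]
  have cf := contDiffAt_inChart hc hf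
  rw [← hτz] at cf
  have h1 : fderiv ℝ (inChart (E := E) c f) (τ (extChartAt 𝓘(ℝ, E) c' z)) = 0 := by
    rw [hτz]; exact congrArg Prod.fst h0
  have h2 : fderiv ℝ (fderiv ℝ (inChart (E := E) c f)) (τ (extChartAt 𝓘(ℝ, E) c' z)) = 0 := by
    rw [hτz, ← coe_jetInChart_snd_snd hc hf, h0]; rfl
  have hderiv : fderiv ℝ (inChart c f ∘ τ) (extChartAt 𝓘(ℝ, E) c' z) = 0 := by
    rw [fderiv_comp _ (cf.differentiableAt (by simp)) (hτ.differentiableAt (by simp)), h1,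
      ContinuousLinearMap.zero_comp]
  have hev := (inChart_comp_eventuallyEq f hΦ.continuousAt hc hc').fderiv (𝕜 := ℝ)
  rw [jetInChart_eq, hev.fderiv_eq, hev.eq_of_nhds, hderiv, fderiv_fderiv_comp_eq_zero cf hτ h1 h2,
    symPart_zero]
  rfl

theorem jetInChart_comp_congr {Y : Type*} [TopologicalSpace Y] [ChartedSpace E Y]
    [IsManifold 𝓘(ℝ, E) 2 Y] {c : X} {c' : Y} {Φ : Y → X} {f g : X → ℝ} {z : Y}
    (hΦ : ContMDiffAt 𝓘(ℝ, E) 𝓘(ℝ, E) 2 Φ z) (hf : ContMDiffAt 𝓘(ℝ, E) 𝓘(ℝ, ℝ) 2 f (Φ z))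
    (hg : ContMDiffAt 𝓘(ℝ, E) 𝓘(ℝ, ℝ) 2 g (Φ z))
    (hc : Φ z ∈ (chartAt E c).source) (hc' : z ∈ (chartAt E c').source)
    (h : jetInChart (E := E) c f (Φ z) = jetInChart c g (Φ z)) :
    jetInChart (E := E) c' (f ∘ Φ) z = jetInChart c' (g ∘ Φ) z := by
  have hzero : (jetInChart (E := E) c (fun w => f w - g w) (Φ z)).2 = 0 := by
    rw [jetInChart_sub hc hf hg, h, sub_self]; rfl
  have hsub := jetInChart_comp_snd_eq_zero hΦ (hf.sub hg) hc hc' hzero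
  have hsplit := jetInChart_sub hc' (hf.comp z hΦ) (hg.comp z hΦ)
  exact Prod.ext (congrArg Prod.fst h :)
    (sub_eq_zero.1 ((congrArg Prod.snd hsplit).symm.trans hsub))

theorem coord_jet2 {c : X} {f : X → ℝ} {x : X} (hx : x ∈ (chartAt E c).source)
    (hf : ContMDiffAt 𝓘(ℝ, E) 𝓘(ℝ, ℝ) 2 f x) :
    (jet2 (E := E) f x).coord c = (extChartAt 𝓘(ℝ, E) c x, jetInChart c f x) :=
  Prod.ext rfl (jetInChart_comp_congr (Φ := id) (c := x) (z := x) contMDiffAt_id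
    (jet2 (E := E) f x).contMDiffAt_rep hf (mem_chart_source E x) hx
    (jet2 (E := E) f x).jetInChart_rep)

end Charts

section JetTopology

variable {E : Type*} [NormedAddCommGroup E] [NormedSpace ℝ E]
  {X : Type*}

/-- The fibrewise affine map `(r, q) ↦ (α r + β, s q)` of the jet bundle; it comprises the
negation of jets, the shifts of their value, and the projection to reduced jets. -/
def Jet2.affine (α β s : ℝ) (j : Jet2 E X) : Jet2 E X := ⟨j.base, (α * j.val.1 + β, s • j.val.2)⟩

/-- The projection `J²(X) → J²_red(X)`, which forgets the value of the function. -/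
def Jet2.toRed (j : Jet2 E X) : RedJet2 E X := ⟨j.base, j.val.2⟩

theorem Jet2.neg_eq_affine (j : Jet2 E X) : j.neg = j.affine (-1) 0 (-1) :=
  Jet2.ext rfl (Prod.ext (by simp [Jet2.neg, Jet2.affine]) (neg_one_smul ℝ j.val.2).symm)

theorem Jet2.neg_neg (j : Jet2 E X) : j.neg.neg = j :=
  Jet2.ext rfl (_root_.neg_neg j.val)

theorem RedJet2.scale_inv_scale {t : ℝ} (ht : t ≠ 0) (j : RedJet2 E X) :
    (j.scale t).scale t⁻¹ = j :=
  RedJet2.ext rfl (inv_smul_smul₀ ht j.val)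

theorem RedJet2.scale_scale_inv {t : ℝ} (ht : t ≠ 0) (j : RedJet2 E X) :
    (j.scale t⁻¹).scale t = j :=
  RedJet2.ext rfl (smul_inv_smul₀ ht j.val)

variable [TopologicalSpace X] [ChartedSpace E X]

theorem Jet2.isOpen_chart (c : X) {V : Set (E × JetFibre E)} (hV : IsOpen V) :
    IsOpen {j : Jet2 E X | j.base ∈ (chartAt E c).source ∧ j.coord c ∈ V} :=
  TopologicalSpace.isOpen_generateFrom_of_mem ⟨c, V, hV, rfl⟩

theorem Jet2.tendsto_nhds {ι : Type*} {l : Filter ι} {J : ι → Jet2 E X} {j : Jet2 E X}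
    (hbase : Tendsto (fun i => (J i).base) l (𝓝 j.base))
    (hcoord : ∀ c, j.base ∈ (chartAt E c).source →
      Tendsto (fun i => (J i).coord c) l (𝓝 (j.coord c))) : Tendsto J l (𝓝 j) := by
  refine TopologicalSpace.tendsto_nhds_generateFrom_iff.2 ?_
  rintro _ ⟨c, V, hV, rfl⟩ ⟨hj, hjV⟩
  exact (hbase.eventually ((chartAt E c).open_source.mem_nhds hj)).and
    ((hcoord c hj).eventually (hV.mem_nhds hjV))

theorem Jet2.continuous_value : Continuous (fun j : Jet2 E X => j.val.1) := by
  refine continuous_iff_continuousAt.2 fun j => continuousAt_def.2 fun I hI => ?_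
  obtain ⟨I', hI'I, hI', hjI'⟩ := mem_nhds_iff.1 hI
  refine mem_of_superset ((Jet2.isOpen_chart j.base (V := {q | q.2.1 ∈ I'})
    (hI'.preimage (continuous_fst.comp continuous_snd))).mem_nhds ⟨mem_chart_source E _, ?_⟩) ?_
  · change j.rep j.base ∈ I'
    rwa [j.rep_base]
  · rintro j' ⟨-, hj'⟩
    change j'.rep j'.base ∈ I' at hj'
    rw [j'.rep_base] at hj'
    exact hI'I hj'

variable [IsManifold 𝓘(ℝ, E) 2 X]

theorem Jet2.coord_affine (α β s : ℝ) {c : X} {j : Jet2 E X}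
    (hj : j.base ∈ (chartAt E c).source) :
    (j.affine α β s).coord c =
      ((j.coord c).1, (α * (j.coord c).2.1 + β, s • (j.coord c).2.2)) := by
  have hrep : (j.affine α β s).rep = fun z => (α * j.val.1 + β - s * j.val.1) + s * j.rep z := by
    ext z
    simp only [Jet2.affine, Jet2.rep, Prod.smul_fst, Prod.smul_snd, Submodule.coe_smul,
      _root_.smul_apply, smul_eq_mul]
    ring
  have hjet : jetInChart (E := E) c (j.affine α β s).rep j.base =
      (α * j.rep j.base + β, s • (jetInChart c j.rep j.base).2) := by
    rw [hrep, jetInChart_const_add_mul _ _ hj j.contMDiffAt_rep, j.rep_base]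
    exact Prod.ext (by ring) rfl
  exact Prod.ext rfl hjet

theorem Jet2.continuous_affine (α β s : ℝ) :
    Continuous (Jet2.affine α β s : Jet2 E X → Jet2 E X) := by
  refine continuous_generateFrom_iff.2 ?_
  rintro _ ⟨c, V, hV, rfl⟩
  have hm : Continuous fun q : E × JetFibre E => (q.1, (α * q.2.1 + β, s • q.2.2)) :=
    continuous_fst.prodMk (((continuous_const.mul (continuous_fst.comp continuous_snd)).add
      continuous_const).prodMk ((continuous_snd.comp continuous_snd).const_smul s))
  convert Jet2.isOpen_chart c (hV.preimage hm) using 1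
  ext j
  refine and_congr_right fun hj => ?_
  rw [Jet2.coord_affine α β s (j := j) hj]
  rfl

theorem Jet2.continuous_neg : Continuous (Jet2.neg : Jet2 E X → Jet2 E X) :=
  (Jet2.continuous_affine (-1) 0 (-1)).congr fun j => j.neg_eq_affine.symm

theorem Jet2.continuous_toRed : Continuous (Jet2.toRed : Jet2 E X → RedJet2 E X) :=
  continuous_induced_rng.2 ((Jet2.continuous_affine 0 0 1).congr fun j =>
    Jet2.ext rfl (Prod.ext (by simp [Jet2.affine, Jet2.toRed, RedJet2.withValue])
      (one_smul ℝ j.val.2)))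

theorem RedJet2.continuous_scale (t : ℝ) : Continuous (RedJet2.scale t : RedJet2 E X → _) :=
  continuous_induced_rng.2 (((Jet2.continuous_affine 1 0 t).comp continuous_induced_dom).congr
    fun j => Jet2.ext rfl (Prod.ext (by simp [Jet2.affine, RedJet2.withValue]) rfl))

theorem RedJet2.isOpenMap_scale {t : ℝ} (ht : t ≠ 0) :
    IsOpenMap (RedJet2.scale t : RedJet2 E X → RedJet2 E X) :=
  IsOpenMap.of_inverse (RedJet2.continuous_scale t⁻¹) (RedJet2.scale_scale_inv ht)
    (RedJet2.scale_inv_scale ht)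

theorem tendsto_jet2_const_add_add_smul {f g : X → ℝ} {x : X}
    (hf : ContMDiffAt 𝓘(ℝ, E) 𝓘(ℝ, ℝ) 2 f x) (hg : ContMDiffAt 𝓘(ℝ, E) 𝓘(ℝ, ℝ) 2 g x) :
    Tendsto (fun q : X × ℝ × ℝ => jet2 (E := E) (fun z => q.2.2 + (f z + q.2.1 * g z)) q.1)
      (𝓝 (x, 0, 0)) (𝓝 (jet2 f x)) := by
  have hfst : Tendsto (fun q : X × ℝ × ℝ => q.1) (𝓝 (x, 0, 0)) (𝓝 x) := continuousAt_fst
  refine Jet2.tendsto_nhds hfst fun c hx => ?_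
  change x ∈ (chartAt E c).source at hx
  have hcoord : ∀ᶠ q : X × ℝ × ℝ in 𝓝 (x, 0, 0),
      (extChartAt 𝓘(ℝ, E) c q.1, ((q.2.2, 0) : JetFibre E) +
        (jetInChart c f q.1 + q.2.1 • jetInChart c g q.1)) =
      (jet2 (E := E) (fun z => q.2.2 + (f z + q.2.1 * g z)) q.1).coord c := by
    filter_upwards [hfst.eventually ((chartAt E c).open_source.mem_nhds hx),
      hfst.eventually (eventually_contMDiffAt_two hf),
      hfst.eventually (eventually_contMDiffAt_two hg)] with q hq hfq hgq
    have hsum : ContMDiffAt 𝓘(ℝ, E) 𝓘(ℝ, ℝ) 2 (fun z => f z + q.2.1 * g z) q.1 :=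
      hfq.add (contMDiffAt_const.mul hgq)
    have hshift : ContMDiffAt 𝓘(ℝ, E) 𝓘(ℝ, ℝ) 2
        (fun z => q.2.2 + (f z + q.2.1 * g z)) q.1 := contMDiffAt_const.add hsum
    rw [coord_jet2 hq hshift, jetInChart_const_add q.2.2 hq hsum,
      jetInChart_add_smul _ hq hfq hgq]
  have hconst : Tendsto (fun q : X × ℝ × ℝ => ((q.2.2, 0) : JetFibre E)) (𝓝 (x, 0, 0)) (𝓝 0) :=
    (continuous_snd.comp continuous_snd).continuousAt.prodMk_nhds tendsto_const_nhds
  have hcoef : Tendsto (fun q : X × ℝ × ℝ => q.2.1) (𝓝 (x, 0, 0)) (𝓝 0) :=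
    (continuous_fst.comp continuous_snd).continuousAt
  have hjet := hconst.add (((continuousAt_jetInChart hx hf).tendsto.comp hfst).add
    (hcoef.smul ((continuousAt_jetInChart hx hg).tendsto.comp hfst)))
  have hχ := (continuousAt_extChartAt' (I := 𝓘(ℝ, E)) (x := c) (x' := x)
    (by simpa using hx)).tendsto.comp hfst
  have hlim : (0 : JetFibre E) + (jetInChart c f x + (0 : ℝ) • jetInChart c g x) =
      jetInChart c f x :=
    (zero_add _).trans ((congrArg (_ + ·) (zero_smul ℝ _)).trans (add_zero _))
  rw [hlim] at hjet
  rw [coord_jet2 hx hf]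
  exact (hχ.prodMk_nhds hjet).congr' hcoord

theorem jet2_const_add_mul {f : X → ℝ} {x : X} (r s : ℝ)
    (hf : ContMDiffAt 𝓘(ℝ, E) 𝓘(ℝ, ℝ) 2 f x) :
    jet2 (E := E) (fun z => r + s * f z) x = ((redJet2 f x).scale s).withValue (r + s * f x) :=
  Jet2.ext rfl (jetInChart_const_add_mul r s (mem_chart_source E x) hf)

theorem jet2_neg {f : X → ℝ} {x : X} (hf : ContMDiffAt 𝓘(ℝ, E) 𝓘(ℝ, ℝ) 2 f x) :
    jet2 (E := E) (fun z => -f z) x = (jet2 f x).neg := by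
  have h := jet2_const_add_mul 0 (-1) hf
  simp only [neg_one_mul, zero_add] at h
  rw [h]
  exact Jet2.ext rfl (Prod.ext rfl (neg_one_smul ℝ (jetInChart (E := E) x f x).2))

end JetTopology

/-! ### Subequations and their duals -/

section Positivity

variable {E : Type*} [NormedAddCommGroup E] [NormedSpace ℝ E]
  {X : Type*}

/-- The positivity condition `F + 𝒫 ⊆ F` of subequations, on its own. -/
def IsPositive (F : Set (Jet2 E X)) : Prop :=
  ∀ (x : X) (r : ℝ) (p : E →L[ℝ] ℝ) (A P : SymForm E),
    (∀ v, 0 ≤ (P : E →L[ℝ] E →L[ℝ] ℝ) v v) →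
    (⟨x, (r, p, A)⟩ : Jet2 E X) ∈ F → (⟨x, (r, p, A + P)⟩ : Jet2 E X) ∈ F

variable [TopologicalSpace X] [ChartedSpace E X]

theorem isLocalMin_inChart {c : X} {f : X → ℝ} {x : X} (hx : x ∈ (chartAt E c).source)
    (hmin : IsLocalMin f x) : IsLocalMin (inChart (E := E) c f) (extChartAt 𝓘(ℝ, E) c x) := by
  have hinv : (extChartAt 𝓘(ℝ, E) c).symm (extChartAt 𝓘(ℝ, E) c x) = x :=
    (extChartAt 𝓘(ℝ, E) c).left_inv (by simpa using hx)
  have hcont := (continuousAt_extChartAt_symm' (I := 𝓘(ℝ, E)) (x := c) (x' := x)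
    (by simpa using hx)).tendsto
  rw [hinv] at hcont
  exact IsMinFilter.comp_tendsto (by rwa [hinv]) hcont

variable [IsManifold 𝓘(ℝ, E) 2 X]

theorem jetInChart_of_isLocalMin {c : X} {f : X → ℝ} {x : X} (hx : x ∈ (chartAt E c).source)
    (hf : ContMDiffAt 𝓘(ℝ, E) 𝓘(ℝ, ℝ) 2 f x) (hmin : IsLocalMin f x) :
    (jetInChart (E := E) c f x).2.1 = 0 ∧
      ∀ v, 0 ≤ ((jetInChart (E := E) c f x).2.2 : E →L[ℝ] E →L[ℝ] ℝ) v v := by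
  refine ⟨(isLocalMin_inChart hx hmin).fderiv_eq_zero, fun v => ?_⟩
  rw [coe_jetInChart_snd_snd hx hf]
  exact fderiv_fderiv_nonneg_of_isLocalMin (contDiffAt_inChart hx hf)
    (isLocalMin_inChart hx hmin) v

theorem IsPositive.jet2_mem_of_eventually_le {F : Set (Jet2 E X)} (hF : IsPositive F)
    {f ψ : X → ℝ} {x : X}
    (hf : ContMDiffAt 𝓘(ℝ, E) 𝓘(ℝ, ℝ) 2 f x) (hψ : ContMDiffAt 𝓘(ℝ, E) 𝓘(ℝ, ℝ) 2 ψ x)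
    (hle : ∀ᶠ z in 𝓝 x, f z ≤ ψ z) (heq : f x = ψ x) (hfF : jet2 f x ∈ F) : jet2 ψ x ∈ F := by
  have hx := mem_chart_source E x
  have hmin : IsLocalMin (fun z => ψ z - f z) x := by
    filter_upwards [hle] with z hz
    rw [heq, sub_self]
    exact sub_nonneg.2 hz
  obtain ⟨hgrad, hhess⟩ := jetInChart_of_isLocalMin hx (hψ.sub hf) hmin
  have hsub := jetInChart_sub (E := E) hx hψ hf
  rw [hsub] at hgrad
  have hmem := hF x _ _ _ _ hhess hfF
  rw [hsub] at hmem
  convert hmem using 1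
  exact Jet2.ext rfl (Prod.ext heq.symm (Prod.ext (sub_eq_zero.1 hgrad)
    (add_sub_cancel (jetInChart (E := E) x f x).2.2 (jetInChart x ψ x).2.2).symm))

end Positivity

section Duality

variable {E : Type*} [NormedAddCommGroup E] [NormedSpace ℝ E]
  {X : Type*}

/-- The negativity condition `F + 𝒩 ⊆ F` of subequations, on its own; the dual inherits it. -/
def IsNegative (F : Set (Jet2 E X)) : Prop :=
  ∀ (x : X) (r s : ℝ) (q : RedFibre E), s ≤ 0 →
    (⟨x, (r, q)⟩ : Jet2 E X) ∈ F → (⟨x, (r + s, q)⟩ : Jet2 E X) ∈ F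

theorem IsNegative.withValue_mem {F : Set (Jet2 E X)} (hF : IsNegative F) {J : RedJet2 E X}
    {r r' : ℝ} (h : r' ≤ r) (hr : J.withValue r ∈ F) : J.withValue r' ∈ F := by
  have := hF J.base r (r' - r) J.val (by linarith) hr
  rwa [add_sub_cancel] at this

variable [TopologicalSpace X] [ChartedSpace E X]

/-- `F` avoids the negatives of the interior points of `F'`. This holds for a subequation and its
dual in either order, so that statements about opposed pairs apply to both. -/
def Opposed (F F' : Set (Jet2 E X)) : Prop := ∀ j ∈ F, j.neg ∉ interior F'

theorem opposed_dual_left (F : Set (Jet2 E X)) : Opposed (dual F) F := fun _ hj => hj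

variable [IsManifold 𝓘(ℝ, E) 2 X]

theorem isClosed_dual (F : Set (Jet2 E X)) : IsClosed (dual F) :=
  isOpen_interior.isClosed_compl.preimage Jet2.continuous_neg

theorem opposed_dual_right {F : Set (Jet2 E X)} (hF : F ⊆ closure (interior F)) :
    Opposed F (dual F) := by
  intro j hj hint
  obtain ⟨j', hj', hj'F⟩ := mem_closure_iff.1 (hF hj) _
    (isOpen_interior.preimage Jet2.continuous_neg) hint
  have hdual : j'.neg ∈ dual F := interior_subset hj'
  exact hdual (by rwa [Jet2.neg_neg])

theorem IsNegative.withValue_mem_interior {F : Set (Jet2 E X)} (hF : IsNegative F)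
    {J : RedJet2 E X} {l r : ℝ} (hJ : J ∈ interior (fixValue F l)) (hr : r < l) :
    J.withValue r ∈ interior F := by
  have hopen : IsOpen {j : Jet2 E X | j.val.1 < l ∧ j.toRed ∈ interior (fixValue F l)} :=
    (isOpen_lt Jet2.continuous_value continuous_const).inter
      (isOpen_interior.preimage Jet2.continuous_toRed)
  refine interior_maximal ?_ hopen ⟨hr, hJ⟩
  rintro j ⟨hjl, hjF⟩
  have hmem : j.toRed ∈ fixValue F l := interior_subset hjF
  exact hF.withValue_mem hjl.le hmem

theorem IsNegative.dual {F : Set (Jet2 E X)} (hF : IsNegative F) : IsNegative (dual F) := by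
  intro x r s q hs hj hint
  apply hj
  have haffine : ∀ j : Jet2 E X, j.affine 1 (-s) 1 = j.toRed.withValue (j.val.1 - s) := fun j =>
    Jet2.ext rfl (Prod.ext (by simp [Jet2.affine, RedJet2.withValue, sub_eq_add_neg])
      (one_smul ℝ j.val.2))
  have hsub : Jet2.affine 1 (-s) 1 ⁻¹' interior F ⊆ F := by
    intro j hj
    rw [mem_preimage, haffine] at hj
    exact hF.withValue_mem (J := j.toRed) (by linarith) (interior_subset hj)
  refine interior_maximal hsub (isOpen_interior.preimage (Jet2.continuous_affine _ _ _)) ?_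
  rw [mem_preimage, haffine]
  convert hint using 1
  refine Jet2.ext rfl (Prod.ext ?_ rfl)
  simp only [Jet2.neg, RedJet2.withValue, Prod.fst_neg]
  ring

theorem Opposed.jet2_const_sub_notMem {F F' : Set (Jet2 E X)} (hFF' : Opposed F F')
    (hF' : IsNegative F') {l t c : ℝ} {h : X → ℝ} {z : X}
    (hh : ContMDiffAt 𝓘(ℝ, E) 𝓘(ℝ, ℝ) 2 h z)
    (hz : (redJet2 h z).scale t ∈ interior (fixValue F' l)) (hc : -l < c - t * h z) :
    jet2 (fun y => c - t * h y) z ∉ F := by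
  intro hmem
  have hsmooth : ContMDiffAt 𝓘(ℝ, E) 𝓘(ℝ, ℝ) 2 (fun y => c - t * h y) z :=
    contMDiffAt_const.sub (contMDiffAt_const.mul hh)
  have hneg : (jet2 (E := E) (fun y => c - t * h y) z).neg =
      ((redJet2 h z).scale t).withValue (-c + t * h z) := by
    rw [← jet2_const_add_mul (-c) t hh, ← jet2_neg hsmooth]
    exact congrArg (jet2 · z) (funext fun y => by ring)
  have hint := hF'.withValue_mem_interior hz (r := -c + t * h z) (by linarith)
  exact hFF' _ hmem (hneg ▸ hint)

end Duality

/-! ### Barriers and invariance -/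

section Barriers

variable {E : Type*} [NormedAddCommGroup E] [NormedSpace ℝ E]
  {X : Type*} [TopologicalSpace X] [ChartedSpace E X]

/-- A peaking barrier at the boundary point `x`: a function `h` on a compact neighbourhood `B` of
`x` which vanishes at `x`, is negative at the other points of `closure Ω`, and whose reduced jets,
scaled by any factor from `t₀` on, lie in the interior of the reduced subequation `F_l`. -/
structure IsBarrier (F : Set (Jet2 E X)) (l : ℝ) (Ω : Set X) (x : X) (B : Set X) (h : X → ℝ)
    (t₀ : ℝ) : Prop where
  compact : IsCompact B
  mem_nhds : B ∈ 𝓝 x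
  contMDiffAt : ∀ z ∈ B, ContMDiffAt 𝓘(ℝ, E) 𝓘(ℝ, ℝ) 2 h z
  eq_zero : h x = 0
  neg : ∀ z ∈ B, z ∈ closure Ω → z ≠ x → h z < 0
  t₀_pos : 0 < t₀
  scale_mem : ∀ t ≥ t₀, ∀ z ∈ B, (redJet2 h z).scale t ∈ interior (fixValue F l)

namespace IsBarrier

variable {F : Set (Jet2 E X)} {l : ℝ} {Ω : Set X} {x : X} {B : Set X} {h : X → ℝ} {t₀ : ℝ}

theorem mem_interior (hb : IsBarrier F l Ω x B h t₀) : x ∈ interior B :=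
  mem_interior_iff_mem_nhds.2 hb.mem_nhds

theorem continuousOn (hb : IsBarrier F l Ω x B h t₀) : ContinuousOn h B :=
  fun z hz => (hb.contMDiffAt z hz).continuousAt.continuousWithinAt

theorem nonpos (hb : IsBarrier F l Ω x B h t₀) {z : X} (hz : z ∈ B) (hzΩ : z ∈ closure Ω) :
    h z ≤ 0 := by
  rcases eq_or_ne z x with rfl | hzx
  · exact hb.eq_zero.le
  · exact (hb.neg z hz hzΩ hzx).le

theorem exists_le_neg (hb : IsBarrier F l Ω x B h t₀) :
    ∃ μ > 0, ∀ z ∈ (B \ interior B) ∩ closure Ω, h z ≤ -μ := by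
  obtain ⟨μ, hμ, hle⟩ := ((hb.compact.diff isOpen_interior).inter_right
    isClosed_closure).exists_forall_le' (f := fun z => -h z) (a := 0)
    (hb.continuousOn.mono fun z hz => hz.1.1).neg fun z hz =>
      neg_pos.2 (hb.neg z hz.1.1 hz.2 fun e => hz.1.2 (e ▸ hb.mem_interior))
  exact ⟨μ, hμ, fun z hz => le_neg.2 (hle z hz)⟩

theorem exists_scale_le (hb : IsBarrier F l Ω x B h t₀) (R : ℝ) :
    ∃ t ≥ t₀, ∀ z ∈ (B \ interior B) ∩ closure Ω, t * h z ≤ -R := by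
  obtain ⟨μ, hμ, hle⟩ := hb.exists_le_neg
  refine ⟨max t₀ (R / μ), le_max_left _ _, fun z hz => ?_⟩
  have ht : 0 ≤ max t₀ (R / μ) := hb.t₀_pos.le.trans (le_max_left _ _)
  calc max t₀ (R / μ) * h z ≤ max t₀ (R / μ) * -μ := mul_le_mul_of_nonneg_left (hle z hz) ht
    _ = -(max t₀ (R / μ) * μ) := mul_neg _ _
    _ ≤ -R := neg_le_neg ((div_le_iff₀ hμ).1 (le_max_right _ _))

end IsBarrier

variable [FiniteDimensional ℝ E]

/-- The squared Euclidean distance to `x` in the preferred chart at `x`, a smooth function which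
serves to make touching functions and barriers strict. -/
def chartDistSq (x z : X) : ℝ :=
  ‖toEuclidean (extChartAt 𝓘(ℝ, E) x z - extChartAt 𝓘(ℝ, E) x x)‖ ^ 2

theorem chartDistSq_self (x : X) : chartDistSq (E := E) x x = 0 := by simp [chartDistSq]

theorem chartDistSq_pos {x z : X} (hz : z ∈ (chartAt E x).source) (hzx : z ≠ x) :
    0 < chartDistSq (E := E) x z := by
  have hne : extChartAt 𝓘(ℝ, E) x z - extChartAt 𝓘(ℝ, E) x x ≠ 0 := fun h =>
    hzx ((extChartAt 𝓘(ℝ, E) x).injOn (by simpa using hz) (by simp) (sub_eq_zero.1 h))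
  exact pow_pos (norm_pos_iff.2 (toEuclidean.map_ne_zero_iff.2 hne)) 2

variable [IsManifold 𝓘(ℝ, E) 2 X]

theorem contMDiffAt_chartDistSq {x z : X} (hz : z ∈ (chartAt E x).source) :
    ContMDiffAt 𝓘(ℝ, E) 𝓘(ℝ, ℝ) 2 (chartDistSq (E := E) x) z := by
  have hχ : ContMDiffAt 𝓘(ℝ, E) 𝓘(ℝ, E) 2 (extChartAt 𝓘(ℝ, E) x) z := contMDiffAt_extChartAt' hz
  have hnorm : ContDiff ℝ 2 (fun y : E => ‖toEuclidean (y - extChartAt 𝓘(ℝ, E) x x)‖ ^ 2) :=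
    ContDiff.norm_sq ℝ (toEuclidean.contDiff.comp (contDiff_id.sub contDiff_const))
  exact hnorm.contMDiff.contMDiffAt.comp z hχ

theorem exists_chartDistSq_ge {B : Set X} (hB : IsCompact B) {x : X} (hxB : B ∈ 𝓝 x)
    (hBs : B ⊆ (chartAt E x).source) :
    ∃ μ > 0, ∀ z ∈ B \ interior B, μ ≤ chartDistSq (E := E) x z :=
  (hB.diff isOpen_interior).exists_forall_le'
    (fun _ hz => (contMDiffAt_chartDistSq (hBs hz.1)).continuousAt.continuousWithinAt)
    fun _ hz => chartDistSq_pos (hBs hz.1) fun e => hz.2 (e ▸ mem_interior_iff_mem_nhds.2 hxB)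

theorem exists_perturbation {f : X → ℝ} {x : X} (hf : ContMDiffAt 𝓘(ℝ, E) 𝓘(ℝ, ℝ) 2 f x)
    {O : Set X} (hO : O ∈ 𝓝 x) {N : Set (Jet2 E X)} (hN : N ∈ 𝓝 (jet2 f x)) :
    ∃ B ⊆ O, IsCompact B ∧ B ∈ 𝓝 x ∧ B ⊆ (chartAt E x).source ∧ ∃ δ₀ > 0, ∀ z ∈ B, ∀ δ,
      ContMDiffAt 𝓘(ℝ, E) 𝓘(ℝ, ℝ) 2 (fun y => f y + δ * chartDistSq (E := E) x y) z ∧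
      (|δ| < δ₀ → ∀ s, |s| < δ₀ →
        jet2 (fun y => s + (f y + δ * chartDistSq (E := E) x y)) z ∈ N) := by
  have := ChartedSpace.locallyCompactSpace E X
  have hd := contMDiffAt_chartDistSq (E := E) (mem_chart_source E x)
  have hjet := tendsto_jet2_const_add_add_smul hf hd hN
  rw [mem_map, nhds_prod_eq] at hjet
  obtain ⟨V, hV, W, hW, hVW⟩ := mem_prod_iff.1 hjet
  obtain ⟨δ₀, hδ₀, hδW⟩ := Metric.mem_nhds_iff.1 hW
  obtain ⟨B, hBn, hBS, hBc⟩ := LocallyCompactSpace.local_compact_nhds x _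
    (inter_mem (inter_mem hO hV) (inter_mem (chart_source_mem_nhds E x)
      (eventually_contMDiffAt_two hf)))
  refine ⟨B, fun z hz => (hBS hz).1.1, hBc, hBn, fun z hz => (hBS hz).2.1, δ₀, hδ₀,
    fun z hz δ => ⟨?_, fun hδ s hs => ?_⟩⟩
  · exact (hBS hz).2.2.add (contMDiffAt_const.mul (contMDiffAt_chartDistSq (hBS hz).2.1))
  · have hδs : (δ, s) ∈ Metric.ball ((0, 0) : ℝ × ℝ) δ₀ := by
      rw [← ball_prod_same]
      exact ⟨by simpa using hδ, by simpa using hs⟩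
    exact hVW (mk_mem_prod (hBS hz).1.2 (hδW hδs))

theorem RedStrictlyConvexAt.exists_isBarrier {F : Set (Jet2 E X)} {l : ℝ} {Ω : Set X} {x : X}
    (hx : x ∈ frontier Ω) (hconv : RedStrictlyConvexAt (fixValue F l) Ω x)
    {O : Set X} (hO : O ∈ 𝓝 x) : ∃ B ⊆ O, ∃ h t₀, IsBarrier F l Ω x B h t₀ := by
  obtain ⟨U, ρ, hU, hxU, hρ, hjet⟩ := hconv
  obtain ⟨N, hN, t₀, ht₀, hNt⟩ := hjet x hxU
  have hρ2 : ContMDiffAt 𝓘(ℝ, E) 𝓘(ℝ, ℝ) 2 ρ x :=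
    ((hρ.smooth x hxU).contMDiffAt (hU.mem_nhds hxU)).of_le (by decide)
  obtain ⟨B, hBO, hBc, hBn, hBs, δ₀, hδ₀, hj⟩ :=
    exists_perturbation hρ2 (inter_mem hO (hU.mem_nhds hxU)) (N := Jet2.toRed ⁻¹' interior N)
      (Jet2.continuous_toRed.continuousAt.preimage_mem_nhds (interior_mem_nhds.2 hN))
  refine ⟨B, fun z hz => (hBO hz).1, fun y => ρ y + -(δ₀ / 2) * chartDistSq (E := E) x y, t₀,
    hBc, hBn, fun z hz => (hj z hz _).1, ?_, ?_, ht₀, ?_⟩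
  · simp only [chartDistSq_self, (hρ.zero_iff x hxU).2 hx, mul_zero, add_zero]
  · intro z hz hzΩ hzx
    have hρz : ρ z ≤ 0 := by
      rw [closure_eq_self_union_frontier] at hzΩ
      rcases hzΩ with h | h
      · exact (hρ.neg z (hBO hz).2 h).le
      · exact ((hρ.zero_iff z (hBO hz).2).2 h).le
    linarith [mul_pos (half_pos hδ₀) (chartDistSq_pos (hBs hz) hzx)]
  · intro t ht z hz
    have hmem := (hj z hz (-(δ₀ / 2))).2 (by rw [abs_neg, abs_of_pos (half_pos hδ₀)]; linarith) 0
      (by simpa using hδ₀)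
    simp only [zero_add] at hmem
    have himage : RedJet2.scale t '' interior N ⊆ fixValue F l :=
      image_subset_iff.2 fun J hJ => hNt t ht J (interior_subset hJ)
    exact interior_maximal himage (RedJet2.isOpenMap_scale (ht₀.trans_le ht).ne' _ isOpen_interior)
      (mem_image_of_mem _ hmem)

end Barriers

section Invariance

variable {E : Type*} [NormedAddCommGroup E] [NormedSpace ℝ E]
  {X : Type*} [TopologicalSpace X] [ChartedSpace E X]

/-- The action of `Φ` on jets: the jet at `y` of `f ∘ Φ` as a function of the jet `v` of `f` at
`Φ y`. -/
def pullJet (Φ : X → X) (y : X) (v : JetFibre E) : JetFibre E :=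
  jetInChart y ((⟨Φ y, v⟩ : Jet2 E X).rep ∘ Φ) y

section

variable {G : Type*} [Group G] [MulAction G X] {F : Set (Jet2 E X)}

theorem IsJetInvariant.jet2_comp_smul_mem_iff (hinv : IsJetInvariant G F)
    {a : G} (hsm : ContMDiff 𝓘(ℝ, E) 𝓘(ℝ, E) 2 (fun z : X => a • z)) {f : X → ℝ} {y : X}
    (hf : ContMDiffAt 𝓘(ℝ, E) 𝓘(ℝ, ℝ) 2 f (a • y)) :
    jet2 (fun z => f (a • z)) y ∈ F ↔ jet2 f (a • y) ∈ F := by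
  constructor <;> intro h
  · simpa only [Function.comp_apply, smul_inv_smul] using hinv a y _ (hf.comp y (hsm y)) h
  · simpa only [inv_inv, inv_smul_smul] using hinv a⁻¹ (a • y) f hf h

theorem IsJetInvariant.fibre_smul (hinv : IsJetInvariant G F) {a : G}
    (hsm : ContMDiff 𝓘(ℝ, E) 𝓘(ℝ, E) 2 (fun z : X => a • z)) (y : X) :
    fibre F (a • y) = pullJet (a • ·) y ⁻¹' fibre F y := by
  ext v
  have h := hinv.jet2_comp_smul_mem_iff hsm (⟨a • y, v⟩ : Jet2 E X).contMDiffAt_rep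
  rw [jet2_rep (⟨a • y, v⟩ : Jet2 E X)] at h
  exact h.symm

end

variable [IsManifold 𝓘(ℝ, E) 2 X]

theorem pullJet_jetInChart {Φ : X → X} {y : X} {f : X → ℝ}
    (hΦ : ContMDiffAt 𝓘(ℝ, E) 𝓘(ℝ, E) 2 Φ y) (hf : ContMDiffAt 𝓘(ℝ, E) 𝓘(ℝ, ℝ) 2 f (Φ y)) :
    pullJet Φ y (jetInChart (E := E) (Φ y) f (Φ y)) = jetInChart y (f ∘ Φ) y :=
  jetInChart_comp_congr hΦ (Jet2.contMDiffAt_rep _) hf (mem_chart_source E _)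
    (mem_chart_source E _) (Jet2.jetInChart_rep _)

theorem pullJet_add_smul {Φ : X → X} {y : X} (hΦ : ContMDiffAt 𝓘(ℝ, E) 𝓘(ℝ, E) 2 Φ y)
    (v w : JetFibre E) (s : ℝ) : pullJet Φ y (v + s • w) = pullJet Φ y v + s • pullJet Φ y w := by
  have hrep : (⟨Φ y, v + s • w⟩ : Jet2 E X).rep ∘ Φ = fun z =>
      (⟨Φ y, v⟩ : Jet2 E X).rep (Φ z) + s * (⟨Φ y, w⟩ : Jet2 E X).rep (Φ z) := by
    ext z
    simp only [Jet2.rep, Function.comp, Prod.fst_add, Prod.snd_add, Prod.smul_fst, Prod.smul_snd,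
      Submodule.coe_add, Submodule.coe_smul, _root_.add_apply, _root_.smul_apply, smul_eq_mul]
    ring
  rw [pullJet, hrep]
  exact jetInChart_add_smul s (mem_chart_source E y)
    ((⟨Φ y, v⟩ : Jet2 E X).contMDiffAt_rep.comp y hΦ)
    ((⟨Φ y, w⟩ : Jet2 E X).contMDiffAt_rep.comp y hΦ)

theorem isLinearMap_pullJet {Φ : X → X} {y : X} (hΦ : ContMDiffAt 𝓘(ℝ, E) 𝓘(ℝ, E) 2 Φ y) :
    IsLinearMap ℝ (pullJet (E := E) Φ y) := by
  have map_add : ∀ v w, pullJet (E := E) Φ y (v + w) = pullJet Φ y v + pullJet Φ y w := by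
    intro v w
    have h := pullJet_add_smul hΦ v w 1
    have hw : (1 : ℝ) • w = w := one_smul ℝ w
    rw [hw] at h
    exact h.trans (congrArg (_ + ·) (one_smul ℝ _))
  have map_zero : pullJet (E := E) Φ y 0 = 0 := by
    have h := map_add 0 0
    rw [add_zero] at h
    exact left_eq_add.1 h
  refine ⟨map_add, fun s v => ?_⟩
  have h := pullJet_add_smul hΦ 0 v s
  rwa [zero_add, map_zero, zero_add] at h

theorem continuous_pullJet [FiniteDimensional ℝ E] {Φ : X → X} {y : X}
    (hΦ : ContMDiffAt 𝓘(ℝ, E) 𝓘(ℝ, E) 2 Φ y) : Continuous (pullJet (E := E) Φ y) :=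
  ((isLinearMap_pullJet hΦ).mk' _).continuous_of_finiteDimensional

variable {G : Type*} [Group G] [MulAction G X] {F : Set (Jet2 E X)}

theorem IsJetInvariant.jet2_mem_interior [FiniteDimensional ℝ E] (hinv : IsJetInvariant G F)
    (hF : ∀ x, interior (fibre F x) = fibre (interior F) x) {a : G}
    (hsm : ContMDiff 𝓘(ℝ, E) 𝓘(ℝ, E) 2 (fun z : X => a • z)) {f : X → ℝ} {y : X}
    (hf : ContMDiffAt 𝓘(ℝ, E) 𝓘(ℝ, ℝ) 2 f (a • y))
    (h : jet2 (fun z => f (a • z)) y ∈ interior F) : jet2 f (a • y) ∈ interior F := by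
  have hopen : IsOpen (pullJet (a • ·) y ⁻¹' interior (fibre F y)) :=
    isOpen_interior.preimage (continuous_pullJet (hsm y))
  have hsub : pullJet (a • ·) y ⁻¹' interior (fibre F y) ⊆ fibre F (a • y) := by
    rw [hinv.fibre_smul hsm y]
    exact preimage_mono interior_subset
  have hmem : jetInChart (a • y) f (a • y) ∈ interior (fibre F (a • y)) := by
    refine interior_maximal hsub hopen ?_
    rw [mem_preimage, pullJet_jetInChart (Φ := (a • ·)) (hsm y) hf, hF]
    exact h
  rwa [hF] at hmem

theorem IsJetInvariant.dual [FiniteDimensional ℝ E] (hinv : IsJetInvariant G F)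
    (hF : ∀ x, interior (fibre F x) = fibre (interior F) x)
    (hsm : ∀ a : G, ContMDiff 𝓘(ℝ, E) 𝓘(ℝ, E) 2 (fun z : X => a • z)) :
    IsJetInvariant G (dual F) := by
  intro a x f hf hfx hmem
  have hax : a⁻¹ • a • x = x := inv_smul_smul a x
  have hnf : ContMDiffAt 𝓘(ℝ, E) 𝓘(ℝ, ℝ) 2 (fun z => -f z) (a⁻¹ • a • x) := by
    rw [hax]
    exact hf.neg
  have hfa : ContMDiffAt 𝓘(ℝ, E) 𝓘(ℝ, ℝ) 2 (fun z => f (a⁻¹ • z)) (a • x) :=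
    ContMDiffAt.comp (g := f) (a • x) (by rwa [hax]) (hsm a⁻¹ (a • x))
  rw [← jet2_neg hfa] at hmem
  have hint := hinv.jet2_mem_interior hF (hsm a⁻¹) hnf hmem
  rw [hax, jet2_neg hf] at hint
  exact hfx hint

end Invariance

/-! ### The a priori bound -/

section AsymptoticMaxima

variable {X : Type*} [TopologicalSpace X] {ι : Type*}

/-- The asymptotic maximum set in `K` of a family of functions bounded by `1`: the points near
which the functions come arbitrarily close to `1`, frequently along `l`. -/
def asymptoticMaxSet (l : Filter ι) (K : Set X) (w : ι → X → ℝ) : Set X :=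
  {z | ∀ V ∈ 𝓝 z, ∀ θ < 1, ∃ᶠ j in l, ∃ y ∈ V ∩ K, θ < w j y}

variable {l : Filter ι} {K : Set X} {w : ι → X → ℝ}

theorem asymptoticMaxSet_subset (hK : IsClosed K) : asymptoticMaxSet l K w ⊆ K := by
  intro z hz
  rw [← hK.closure_eq]
  refine mem_closure_iff_nhds.2 fun V hV => ?_
  obtain ⟨j, y, hy, -⟩ := (hz V hV 0 one_pos).exists
  exact ⟨y, hy⟩

theorem isClosed_asymptoticMaxSet : IsClosed (asymptoticMaxSet l K w) := by
  refine isClosed_of_closure_subset fun z hz V hV θ hθ => ?_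
  obtain ⟨z', hz'V, hz'⟩ := mem_closure_iff_nhds.1 hz _ (interior_mem_nhds.2 hV)
  exact hz' V (mem_interior_iff_mem_nhds.1 hz'V) θ hθ

theorem asymptoticMaxSet_nonempty [l.NeBot] (hK : IsCompact K) {y : ι → X} (hy : ∀ j, y j ∈ K)
    (hw : ∀ j, w j (y j) = 1) : (asymptoticMaxSet l K w).Nonempty := by
  obtain ⟨z, -, hz⟩ := hK.exists_mapClusterPt (f := l) (u := y)
    (tendsto_principal.2 (Eventually.of_forall hy))
  refine ⟨z, fun V hV θ hθ => (mapClusterPt_iff_frequently.1 hz V hV).mono fun j hj => ?_⟩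
  exact ⟨y j, ⟨hj, hy j⟩, by rwa [hw]⟩

theorem mem_asymptoticMaxSet_comp (e : X ≃ₜ X) {x : X} :
    x ∈ asymptoticMaxSet l (e ⁻¹' K) (fun j z => w j (e z)) ↔ e x ∈ asymptoticMaxSet l K w := by
  constructor <;> intro h V hV θ hθ
  · refine (h (e ⁻¹' V) (e.continuous.continuousAt hV) θ hθ).mono ?_
    rintro j ⟨y, hyVK, hy⟩
    exact ⟨e y, hyVK, hy⟩
  · refine (h (e '' V) (e.isOpenMap.image_mem_nhds hV) θ hθ).mono ?_
    rintro j ⟨_, ⟨⟨y, hyV, rfl⟩, hyK⟩, hy⟩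
    exact ⟨y, ⟨hyV, hyK⟩, hy⟩

theorem exists_eventually_le_of_disjoint_asymptoticMaxSet {T : Set X} (hT : IsCompact T)
    (hdisj : Disjoint T (asymptoticMaxSet l K w)) :
    ∃ θ < 1, ∀ᶠ j in l, ∀ y ∈ T ∩ K, w j y ≤ θ := by
  refine hT.induction_on (p := fun S => ∃ θ < 1, ∀ᶠ j in l, ∀ y ∈ S ∩ K, w j y ≤ θ)
    ⟨0, one_pos, by simp⟩ ?mono ?union ?nhds
  case mono =>
    rintro S T hST ⟨θ, hθ, hev⟩
    exact ⟨θ, hθ, hev.mono fun j hj y hy => hj y ⟨hST hy.1, hy.2⟩⟩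
  case union =>
    rintro S T ⟨θ₁, hθ₁, hev₁⟩ ⟨θ₂, hθ₂, hev₂⟩
    refine ⟨max θ₁ θ₂, max_lt hθ₁ hθ₂, ?_⟩
    filter_upwards [hev₁, hev₂] with j h₁ h₂ y hy
    exact hy.1.elim (fun h => (h₁ y ⟨h, hy.2⟩).trans (le_max_left _ _))
      fun h => (h₂ y ⟨h, hy.2⟩).trans (le_max_right _ _)
  case nhds =>
    intro z hz
    have hzZ := disjoint_left.1 hdisj hz
    simp only [asymptoticMaxSet, mem_ofPred_eq, not_forall, not_frequently] at hzZ
    obtain ⟨V, hV, θ, hθ, hev⟩ := hzZ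
    exact ⟨V, mem_nhdsWithin_of_mem_nhds hV, θ, hθ,
      hev.mono fun j hj y hy => not_lt.1 fun h => hj ⟨y, hy, h⟩⟩

variable [T2Space X]

theorem exists_forall_eventually_add_mul_le {S : Set X} {h : X → ℝ} (hS : IsCompact S)
    (hh : ContinuousOn h S) (hneg : ∀ z ∈ S ∩ asymptoticMaxSet l K w, h z < 0)
    (hw : ∀ j, ∀ y ∈ K, w j y ≤ 1) :
    ∃ ε₀ > 0, ∀ ε > 0, ε ≤ ε₀ → ∃ θ < 1, ∀ᶠ j in l, ∀ y ∈ S ∩ K, w j y + ε * h y ≤ θ := by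
  obtain ⟨μ, hμ, hle⟩ := (hS.inter_right isClosed_asymptoticMaxSet).exists_forall_le'
    (hh.mono inter_subset_left).neg fun z hz => neg_pos.2 (hneg z hz)
  obtain ⟨θ, hθ, hev⟩ := exists_eventually_le_of_disjoint_asymptoticMaxSet
    (l := l) (K := K) (w := w) (T := S ∩ h ⁻¹' Ici (-(μ / 2)))
    (hS.of_isClosed_subset (hh.preimage_isClosed_of_isClosed hS.isClosed isClosed_Ici)
      inter_subset_left)
    (disjoint_left.2 fun z hz hzZ => by
      have hge : -(μ / 2) ≤ h z := hz.2
      have hlt : μ ≤ -h z := hle z ⟨hz.1, hzZ⟩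
      linarith)
  obtain ⟨H, hH⟩ := hS.exists_bound_of_continuousOn hh
  refine ⟨(1 - θ) / (2 * max H 1), by have := le_max_right H 1; apply div_pos <;> linarith,
    fun ε hε hεle => ⟨max ((1 + θ) / 2) (1 - ε * (μ / 2)), max_lt (by linarith) ?_, ?_⟩⟩
  · linarith [mul_pos hε (half_pos hμ)]
  filter_upwards [hev] with j hj y hy
  rcases le_or_gt (-(μ / 2)) (h y) with hlarge | hsmall
  · refine le_max_of_le_left ?_
    have hhH : h y ≤ max H 1 := (le_abs_self _).trans ((hH y hy.1).trans (le_max_left _ _))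
    have hεh : ε * h y ≤ (1 - θ) / 2 := by
      rw [le_div_iff₀ (by positivity)] at hεle
      linarith [mul_le_mul_of_nonneg_left hhH hε.le]
    linarith [hj y ⟨⟨hy.1, hlarge⟩, hy.2⟩]
  · refine le_max_of_le_right ?_
    linarith [hw j y hy.2, mul_lt_mul_of_pos_left hsmall hε]

theorem exists_frequently_isMaxOn_of_mem_asymptoticMaxSet {x : X} {B : Set X} {h : X → ℝ}
    (hx : x ∈ asymptoticMaxSet l K w) (hK : IsClosed K) (hB : IsCompact B) (hxB : x ∈ interior B)
    (hh : ContinuousOn h B) (hhx : h x = 0)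
    (hneg : ∀ z ∈ (B \ interior B) ∩ asymptoticMaxSet l K w, h z < 0)
    (hw : ∀ j, ∀ y ∈ K, w j y ≤ 1) (hwusc : ∀ j, UpperSemicontinuousOn (w j) K) :
    ∃ ε > 0, ∃ᶠ j in l, ∃ z ∈ interior B ∩ K,
      IsMaxOn (fun y => w j y + ε * h y) (B ∩ K) z ∧ 1 / 2 < w j z := by
  obtain ⟨ε₀, hε₀, hbdry⟩ := exists_forall_eventually_add_mul_le (hB.diff isOpen_interior)
    (hh.mono sdiff_subset) hneg hw
  obtain ⟨H, hH⟩ := hB.exists_bound_of_continuousOn hh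
  obtain ⟨ε, hε, hεε₀, hεH⟩ : ∃ ε > 0, ε ≤ ε₀ ∧ ε * max H 1 ≤ 1 / 4 := by
    have hpos : 0 < max H 1 := one_pos.trans_le (le_max_right _ _)
    refine ⟨min ε₀ (1 / 4 / max H 1), lt_min hε₀ (by positivity), min_le_left _ _, ?_⟩
    exact (le_div_iff₀ hpos).1 (min_le_right _ _)
  obtain ⟨θ, hθ, hev⟩ := hbdry ε hε hεε₀
  set θ' := max θ (3 / 4)
  have hθ' : θ' < 1 := max_lt hθ (by norm_num)
  have hV : {y | -((1 - θ') / 2) < ε * h y} ∩ interior B ∈ 𝓝 x := by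
    have hcont := (hh.continuousAt (mem_interior_iff_mem_nhds.1 hxB)).const_mul ε
    refine inter_mem (hcont.eventually (lt_mem_nhds ?_)) (isOpen_interior.mem_nhds hxB)
    simp only [hhx]
    linarith
  refine ⟨ε, hε, ((hx _ hV ((1 + θ') / 2) (by linarith)).and_eventually hev).mono ?_⟩
  rintro j ⟨⟨y, ⟨⟨hyh, hyB⟩, hyK⟩, hy⟩, hj⟩
  have husc : UpperSemicontinuousOn (fun y => w j y + ε * h y) (B ∩ K) :=
    ((hwusc j).mono inter_subset_right).add
      ((hh.mono inter_subset_left).const_mul ε).upperSemicontinuousOn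
  have hyBK : y ∈ B ∩ K := ⟨interior_subset hyB, hyK⟩
  obtain ⟨z, hz, hzmax⟩ := husc.exists_isMaxOn ⟨y, hyBK⟩ (hB.inter_right hK)
  have hzval : θ' < w j z + ε * h z := by
    have hyh' : -((1 - θ') / 2) < ε * h y := hyh
    linarith [isMaxOn_iff.1 hzmax y hyBK]
  have hzint : z ∈ interior B := by
    by_contra hzB
    exact (hj z ⟨⟨hz.1, hzB⟩, hz.2⟩).not_gt ((le_max_left _ _).trans_lt hzval)
  have hεz : ε * h z ≤ 1 / 4 := (mul_le_mul_of_nonneg_left ((le_abs_self _).trans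
    ((hH z hz.1).trans (le_max_left _ _))) hε.le).trans hεH
  exact ⟨z, ⟨hzint, hz.2⟩, hzmax, by linarith [le_max_right θ (3 / 4)]⟩

end AsymptoticMaxima

section Touching

variable {G : Type*} [Group G] [TopologicalSpace G] {X : Type*} [TopologicalSpace X] [MulAction G X]

theorem isClopen_orbit_of_isOpen {C : Subgroup G} (hC : IsOpen (C : Set G))
    (horb : ∀ x : X, IsOpenMap fun a : G => a • x) (x : X) :
    IsClopen (MulAction.orbit C x) := by
  have hopen : ∀ y : X, IsOpen (MulAction.orbit C y) := by
    intro y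
    have himage : MulAction.orbit C y = (fun a : G => a • y) '' C := by
      rw [image_eq_range]
      rfl
    exact himage ▸ horb y _ hC
  refine ⟨isClosed_of_closure_subset fun y hy => ?_, hopen x⟩
  obtain ⟨z, hzx, hzy⟩ := mem_closure_iff.1 hy _ (hopen y) (MulAction.mem_orbit_self y)
  rw [← MulAction.orbit_eq_iff] at hzx hzy ⊢
  exact (hzy.symm.trans hzx).symm

variable [IsTopologicalGroup G] [ContinuousSMul G X]

theorem isOpen_setOf_forall_inv_smul_mem {Ω Z : Set X} (hΩ : IsOpen Ω) (hZ : IsCompact Z) :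
    IsOpen {a : G | ∀ z ∈ Z, a⁻¹ • z ∈ Ω} := by
  refine isOpen_iff_mem_nhds.2 fun a ha => ?_
  refine hZ.eventually_forall_of_forall_eventually fun z hz => ?_
  have hcont : Continuous fun q : G × X => q.1⁻¹ • q.2 := continuous_fst.inv.smul continuous_snd
  exact (hΩ.preimage hcont).mem_nhds (ha z hz)

theorem exists_inv_smul_mem_frontier [LocallyConnectedSpace G]
    (horb : ∀ x : X, IsOpenMap fun a : G => a • x) {Ω Z : Set X} (hΩ : IsOpen Ω)
    (hconn : IsPreconnected Ω) (hfr : (frontier Ω).Nonempty) (hZ : IsCompact Z)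
    (hZne : Z.Nonempty) (hZΩ : Z ⊆ Ω) :
    ∃ a : G, (∀ z ∈ Z, a⁻¹ • z ∈ closure Ω) ∧ ∃ z ∈ Z, a⁻¹ • z ∈ frontier Ω := by
  set S : Set G := {a | ∀ z ∈ Z, a⁻¹ • z ∈ Ω} with hS_def
  have hS : ¬IsClosed S := by
    intro hSclosed
    have hC : connectedComponent (1 : G) ⊆ S := isPreconnected_connectedComponent.subset_isClopen
      ⟨hSclosed, isOpen_setOf_forall_inv_smul_mem hΩ hZ⟩
      ⟨1, mem_connectedComponent, fun z hz => by simpa using hZΩ hz⟩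
    obtain ⟨z, hz⟩ := hZne
    have horbit := isClopen_orbit_of_isOpen (C := Subgroup.connectedComponentOfOne G)
      isOpen_connectedComponent horb z
    have hΩorbit : Ω = MulAction.orbit (Subgroup.connectedComponentOfOne G) z := by
      refine (hconn.subset_isClopen horbit
        ⟨z, hZΩ hz, MulAction.mem_orbit_self z⟩).antisymm ?_
      rintro _ ⟨c, rfl⟩
      have := hC (inv_mem c.2) z hz
      rwa [inv_inv] at this
    rw [hΩorbit, horbit.frontier_eq] at hfr
    exact not_nonempty_empty hfr
  obtain ⟨a, ha, haS⟩ := not_subset.1 (mt isClosed_of_closure_subset hS)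
  have hcl : ∀ z ∈ Z, a⁻¹ • z ∈ closure Ω := fun z hz =>
    map_mem_closure (f := fun b : G => b⁻¹ • z) (continuous_inv.smul continuous_const) ha
      fun b hb => hb z hz
  simp only [hS_def, mem_ofPred_eq, not_forall] at haS
  obtain ⟨z, hz, hza⟩ := haS
  exact ⟨a, hcl, z, hz, hΩ.frontier_eq ▸ ⟨hcl z hz, hza⟩⟩

end Touching

section APriori

variable {E : Type*} [NormedAddCommGroup E] [NormedSpace ℝ E]
  {X : Type*} [TopologicalSpace X] [ChartedSpace E X]

/-- The viscosity condition at the point `x`: the jets at `x` of all `C²` functions touching `u`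
from above at `x` lie in `F`. No semicontinuity is included. -/
def IsSubharmonicAt (F : Set (Jet2 E X)) (u : X → ℝ) (x : X) : Prop :=
  ∀ ψ : X → ℝ, ContMDiffAt 𝓘(ℝ, E) 𝓘(ℝ, ℝ) 2 ψ x → (∀ᶠ z in 𝓝 x, u z ≤ ψ z) → u x = ψ x →
    jet2 ψ x ∈ F

theorem IsSubharmonicAt.comp_smul {G : Type*} [Group G] [MulAction G X] {F : Set (Jet2 E X)}
    (hinv : IsJetInvariant G F)
    (hsm : ∀ a : G, ContMDiff 𝓘(ℝ, E) 𝓘(ℝ, E) 2 (fun z : X => a • z))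
    {u : X → ℝ} {a : G} {x : X} (h : IsSubharmonicAt F u (a • x)) :
    IsSubharmonicAt F (fun z => u (a • z)) x := by
  intro ψ hψ hle heq
  obtain ⟨ψ', rfl⟩ : ∃ ψ' : X → ℝ, ψ = fun z => ψ' (a • z) :=
    ⟨fun z => ψ (a⁻¹ • z), by simp only [inv_smul_smul]⟩
  have hinv_tendsto : Tendsto (fun z : X => a⁻¹ • z) (𝓝 (a • x)) (𝓝 x) := by
    have := (hsm a⁻¹).continuous.tendsto (a • x)
    rwa [inv_smul_smul] at this
  have hψ' : ContMDiffAt 𝓘(ℝ, E) 𝓘(ℝ, ℝ) 2 ψ' (a • x) := by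
    have := ContMDiffAt.comp (g := fun z => ψ' (a • z)) (a • x) (by rwa [inv_smul_smul])
      (hsm a⁻¹ (a • x))
    simpa only [Function.comp_def, smul_inv_smul] using this
  have hle' : ∀ᶠ z in 𝓝 (a • x), u z ≤ ψ' z := by
    simpa only [smul_inv_smul] using hinv_tendsto.eventually hle
  exact (hinv.jet2_comp_smul_mem_iff (hsm a) hψ').2 (h ψ' hψ' hle' heq)

/-- A normalised blow-up on `K`: functions `w j ≤ 1`, together with factors `M j → ∞`, such that
`M j * w j` is `F`-subharmonic at the points where `w j > 1 / 2`, which are interior to `K`. -/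
structure IsBlowUp {ι : Type*} (F : Set (Jet2 E X)) (K : Set X) (l : Filter ι) (w : ι → X → ℝ)
    (M : ι → ℝ) : Prop where
  isClosed : IsClosed K
  upperSemicontinuousOn : ∀ j, UpperSemicontinuousOn (w j) K
  le_one : ∀ j, ∀ y ∈ K, w j y ≤ 1
  tendsto : Tendsto M l atTop
  mem_nhds : ∀ j, ∀ y ∈ K, 1 / 2 < w j y → K ∈ 𝓝 y
  isSubharmonicAt : ∀ j, ∀ y ∈ K, 1 / 2 < w j y → IsSubharmonicAt F (fun z => M j * w j z) y

section

variable {ι : Type*} {F : Set (Jet2 E X)} {K : Set X} {l : Filter ι} {w : ι → X → ℝ} {M : ι → ℝ}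

theorem IsBlowUp.comp_smul {G : Type*} [Group G] [MulAction G X] (hw : IsBlowUp F K l w M)
    (hinv : IsJetInvariant G F)
    (hsm : ∀ a : G, ContMDiff 𝓘(ℝ, E) 𝓘(ℝ, E) 2 (fun z : X => a • z)) (a : G) :
    IsBlowUp F ((fun z : X => a • z) ⁻¹' K) l (fun j z => w j (a • z)) M where
  isClosed := hw.isClosed.preimage (hsm a).continuous
  upperSemicontinuousOn j :=
    (hw.upperSemicontinuousOn j).comp (hsm a).continuous.continuousOn fun _ hz => hz
  le_one j _ hy := hw.le_one j _ hy
  tendsto := hw.tendsto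
  mem_nhds j _ hy hjy := (hsm a).continuous.continuousAt (hw.mem_nhds j _ hy hjy)
  isSubharmonicAt j _ hy hjy := (hw.isSubharmonicAt j _ hy hjy).comp_smul hinv hsm

end

variable [IsManifold 𝓘(ℝ, E) 2 X]

theorem IsBarrier.le_of_isLocalMax {F F' : Set (Jet2 E X)} {l : ℝ} {Ω : Set X} {x : X}
    {B : Set X} {h : X → ℝ} {t₀ : ℝ} (hb : IsBarrier F' l Ω x B h t₀) (hopp : Opposed F F')
    (hneg : IsNegative F') {t : ℝ} (ht : t₀ ≤ t) {u : X → ℝ} {z : X} (hz : z ∈ B)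
    (hu : IsSubharmonicAt F u z) (hmax : IsLocalMax (fun y => u y + t * h y) z) : u z ≤ -l := by
  by_contra! hlt
  have hh := hb.contMDiffAt z hz
  refine hopp.jet2_const_sub_notMem hneg hh (hb.scale_mem t ht z hz) (c := u z + t * h z)
    (by linarith) (hu _ (contMDiffAt_const.sub (contMDiffAt_const.mul hh)) ?_ (by ring))
  exact hmax.mono fun y hy => by linarith

theorem IsBarrier.notMem_asymptoticMaxSet [T2Space X] {ι : Type*} {F F' : Set (Jet2 E X)}
    {Ω K B : Set X} {x : X} {h : X → ℝ} {t₀ : ℝ} {l : Filter ι} {w : ι → X → ℝ} {M : ι → ℝ}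
    (hb : IsBarrier F' 0 Ω x B h t₀) (hopp : Opposed F F') (hneg : IsNegative F')
    (hw : IsBlowUp F K l w M) (hZ : asymptoticMaxSet l K w ⊆ closure Ω) :
    x ∉ asymptoticMaxSet l K w := by
  intro hx
  obtain ⟨ε, hε, hfreq⟩ := exists_frequently_isMaxOn_of_mem_asymptoticMaxSet hx hw.isClosed
    hb.compact hb.mem_interior hb.continuousOn hb.eq_zero
    (fun z hz => hb.neg z hz.1.1 (hZ hz.2) fun e => hz.1.2 (e ▸ hb.mem_interior))
    hw.le_one hw.upperSemicontinuousOn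
  have hlarge : ∀ᶠ j in l, 0 < M j ∧ t₀ ≤ M j * ε :=
    (hw.tendsto.eventually_gt_atTop 0).and ((hw.tendsto.atTop_mul_const hε).eventually_ge_atTop t₀)
  obtain ⟨j, ⟨z, ⟨hzB, hzK⟩, hmax, hwz⟩, hM, ht⟩ := (hfreq.and_eventually hlarge).exists
  have hlocal : IsLocalMax (fun y => M j * w j y + M j * ε * h y) z := by
    filter_upwards [hw.mem_nhds j z hzK hwz, mem_interior_iff_mem_nhds.1 hzB] with y hyK hyB
    have hle := mul_le_mul_of_nonneg_left (isMaxOn_iff.1 hmax y ⟨hyB, hyK⟩) hM.le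
    linarith
  have hle := hb.le_of_isLocalMax hopp hneg ht (interior_subset hzB)
    (hw.isSubharmonicAt j z hzK hwz) hlocal
  have hpos : 0 < M j * w j z := mul_pos hM (by linarith)
  linarith

variable [FiniteDimensional ℝ E] [T2Space X]
  {G : Type*} [Group G] [TopologicalSpace G] [IsTopologicalGroup G] [LocallyConnectedSpace G]
  [MulAction G X] [ContinuousSMul G X]

theorem IsBlowUp.asymptoticMaxSet_eq_empty {ι : Type*} {F F' : Set (Jet2 E X)} {Ω : Set X}
    {l : Filter ι} {w : ι → X → ℝ} {M : ι → ℝ} (hw : IsBlowUp F (closure Ω) l w M)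
    (hopp : Opposed F F') (hneg : IsNegative F') (hinv : IsJetInvariant G F)
    (hsm : ∀ a : G, ContMDiff 𝓘(ℝ, E) 𝓘(ℝ, E) 2 (fun z : X => a • z))
    (horb : ∀ x : X, IsOpenMap fun a : G => a • x)
    (hΩ : IsOpen Ω) (hconn : IsPreconnected Ω) (hcpt : IsCompact (closure Ω))
    (hfr : (frontier Ω).Nonempty) (hconv : HasStrictlyConvexBoundary F' Ω) :
    asymptoticMaxSet l (closure Ω) w = ∅ := by
  set Z := asymptoticMaxSet l (closure Ω) w
  have hZcl : Z ⊆ closure Ω := asymptoticMaxSet_subset isClosed_closure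
  have hZΩ : Z ⊆ Ω := by
    intro z hz
    by_contra hzΩ
    have hzf : z ∈ frontier Ω := hΩ.frontier_eq ▸ ⟨hZcl hz, hzΩ⟩
    obtain ⟨B, -, h, t₀, hb⟩ := (hconv z hzf 0).exists_isBarrier hzf univ_mem
    exact hb.notMem_asymptoticMaxSet hopp hneg hw hZcl hz
  by_contra hne
  obtain ⟨a, hacl, z, hz, hzf⟩ := exists_inv_smul_mem_frontier horb hΩ hconn hfr
    (hcpt.of_isClosed_subset isClosed_asymptoticMaxSet hZcl) (nonempty_iff_ne_empty.2 hne) hZΩ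
  have hmem : ∀ y, y ∈ asymptoticMaxSet l ((fun z : X => a • z) ⁻¹' closure Ω)
      (fun j z => w j (a • z)) ↔ a • y ∈ Z := fun y => mem_asymptoticMaxSet_comp (Homeomorph.smul a)
  obtain ⟨B, -, h, t₀, hb⟩ := (hconv _ hzf 0).exists_isBarrier hzf univ_mem
  refine hb.notMem_asymptoticMaxSet hopp hneg (hw.comp_smul hinv hsm a) (fun y hy => ?_) ?_
  · simpa only [inv_smul_smul] using hacl _ ((hmem y).1 hy)
  · rwa [hmem, smul_inv_smul]

theorem exists_upper_bound {F F' : Set (Jet2 E X)} {Ω : Set X} (hopp : Opposed F F')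
    (hneg : IsNegative F') (hinv : IsJetInvariant G F)
    (hsm : ∀ a : G, ContMDiff 𝓘(ℝ, E) 𝓘(ℝ, E) 2 (fun z : X => a • z))
    (horb : ∀ x : X, IsOpenMap fun a : G => a • x)
    (hΩ : IsOpen Ω) (hconn : IsPreconnected Ω) (hcpt : IsCompact (closure Ω))
    (hfr : (frontier Ω).Nonempty) (hconv : HasStrictlyConvexBoundary F' Ω) (m : ℝ) :
    ∃ C, ∀ u : X → ℝ, UpperSemicontinuousOn u (closure Ω) → (∀ x ∈ frontier Ω, u x ≤ m) →
      (∀ x ∈ Ω, m < u x → IsSubharmonicAt F u x) → ∀ x ∈ closure Ω, u x ≤ C := by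
  by_contra! hunbounded
  choose u husc hum hut x hx hxu using fun n : ℕ => hunbounded (2 * |m| + n)
  choose y hy hymax using fun n => (husc n).exists_isMaxOn ⟨x n, hx n⟩ hcpt
  set M : ℕ → ℝ := fun n => u n (y n)
  have hM : ∀ n, 2 * |m| + n < M n := fun n => (hxu n).trans_le (isMaxOn_iff.1 (hymax n) _ (hx n))
  have hMpos : ∀ n, 0 < M n := fun n => (by positivity : (0 : ℝ) ≤ 2 * |m| + n).trans_lt (hM n)
  have hlt : ∀ n z, 1 / 2 < u n z / M n → m < u n z := by
    intro n z hz
    rw [lt_div_iff₀ (hMpos n)] at hz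
    linarith [hM n, le_abs_self m, n.cast_nonneg (α := ℝ)]
  have hin : ∀ n, ∀ z ∈ closure Ω, 1 / 2 < u n z / M n → z ∈ Ω := by
    intro n z hz hzu
    by_contra hzΩ
    exact (hum n z (hΩ.frontier_eq ▸ ⟨hz, hzΩ⟩)).not_gt (hlt n z hzu)
  have hblow : IsBlowUp F (closure Ω) atTop (fun n z => u n z / M n) M :=
    { isClosed := isClosed_closure
      upperSemicontinuousOn := fun n => (continuous_id.div_const (M n)).comp_upperSemicontinuousOn
        (husc n) fun _ _ hab => div_le_div_of_nonneg_right hab (hMpos n).le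
      le_one := fun n z hz => (div_le_one (hMpos n)).2 (isMaxOn_iff.1 (hymax n) z hz)
      tendsto := tendsto_atTop_mono
        (fun n => by linarith [hM n, abs_nonneg m]) tendsto_natCast_atTop_atTop
      mem_nhds := fun n z hz hzu =>
        mem_of_superset (hΩ.mem_nhds (hin n z hz hzu)) subset_closure
      isSubharmonicAt := fun n z hz hzu => by
        simpa only [mul_div_cancel₀ _ (hMpos n).ne'] using hut n z (hin n z hz hzu) (hlt n z hzu) }
  have hne := asymptoticMaxSet_nonempty (l := atTop) (w := fun n z => u n z / M n) hcpt hy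
    (fun n => div_self (hMpos n).ne')
  rw [hblow.asymptoticMaxSet_eq_empty hopp hneg hinv hsm horb hΩ hconn hcpt hfr hconv] at hne
  exact not_nonempty_empty hne

end APriori

/-! ### Perron's method -/

section UpperEnvelope

variable {X : Type*} [TopologicalSpace X]

/-- The upper semicontinuous regularization, on `K`, of the pointwise supremum of the family `S` of
functions. It is junk unless `S` is nonempty and locally bounded above on `K`. -/
def uscSup (K : Set X) (S : Set (X → ℝ)) (x : X) : ℝ :=
  sInf {y | ∀ᶠ z in 𝓝[K] x, ∀ u ∈ S, u z ≤ y}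

variable {K : Set X} {S : Set (X → ℝ)} {x : X}

theorem uscSup_le (hS : S.Nonempty) (hx : x ∈ K) {y : ℝ}
    (h : ∀ᶠ z in 𝓝[K] x, ∀ u ∈ S, u z ≤ y) : uscSup K S x ≤ y := by
  obtain ⟨u, hu⟩ := hS
  exact csInf_le ⟨u x, fun y (hy : ∀ᶠ z in 𝓝[K] x, ∀ u ∈ S, u z ≤ y) =>
    hy.self_of_nhdsWithin hx u hu⟩ h

theorem frequently_exists_lt_of_lt_uscSup (hS : S.Nonempty) (hx : x ∈ K) {y : ℝ}
    (h : y < uscSup K S x) : ∃ᶠ z in 𝓝[K] x, ∃ u ∈ S, y < u z := by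
  intro hcon
  refine h.not_ge (uscSup_le hS hx ?_)
  filter_upwards [hcon] with z hz u hu using not_lt.1 fun hlt => hz ⟨u, hu, hlt⟩

variable {C : ℝ}

theorem le_uscSup (hC : ∀ u ∈ S, ∀ x ∈ K, u x ≤ C) {u : X → ℝ} (hu : u ∈ S) (hx : x ∈ K) :
    u x ≤ uscSup K S x :=
  le_csInf ⟨C, eventually_nhdsWithin_of_forall fun z hz u hu => hC u hu z hz⟩
    fun y (hy : ∀ᶠ z in 𝓝[K] x, ∀ u ∈ S, u z ≤ y) => hy.self_of_nhdsWithin hx u hu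

theorem upperSemicontinuousOn_uscSup (hS : S.Nonempty) (hC : ∀ u ∈ S, ∀ x ∈ K, u x ≤ C) :
    UpperSemicontinuousOn (uscSup K S) K := by
  intro x _
  refine upperSemicontinuousWithinAt_iff.2 fun y hy => ?_
  obtain ⟨y', hy', hlt⟩ := exists_lt_of_csInf_lt
    ⟨C, eventually_nhdsWithin_of_forall fun z hz u hu => hC u hu z hz⟩ hy
  filter_upwards [eventually_eventually_nhdsWithin.2 hy', self_mem_nhdsWithin] with z hz hzK
  exact (uscSup_le hS hzK hz).trans_lt hlt

theorem exists_isLocalMax_mem_open {O : Set X} {v : X → ℝ} (hK : IsCompact K) (hO : IsOpen O)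
    (hOK : O ⊆ K) (hv : UpperSemicontinuousOn v K) {z : X} (hz : z ∈ K)
    (hlt : ∀ y ∈ K \ O, v y < v z) : ∃ w ∈ O, IsLocalMax v w ∧ v z ≤ v w := by
  obtain ⟨w, hwK, hmax⟩ := hv.exists_isMaxOn ⟨z, hz⟩ hK
  have hzw : v z ≤ v w := isMaxOn_iff.1 hmax z hz
  have hwO : w ∈ O := by
    by_contra hwO
    exact (hlt w ⟨hwK, hwO⟩).not_ge hzw
  exact ⟨w, hwO, hmax.isLocalMax (mem_of_superset (hO.mem_nhds hwO) hOK), hzw⟩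

end UpperEnvelope

section Glue

variable {X : Type*}

open Classical in
/-- The maximum of `u` and `g` on `B`, and `u` elsewhere: the modification of `u` by `g` on `B` by
which competitors in the Perron method are improved. -/
def glue (B : Set X) (u g : X → ℝ) (z : X) : ℝ := if z ∈ B then max (u z) (g z) else u z

variable {B : Set X} (u g : X → ℝ)

theorem le_glue (B : Set X) (z : X) : u z ≤ glue B u g z := by
  unfold glue
  split_ifs
  · exact le_max_left _ _
  · exact le_rfl

theorem le_glue_of_mem {z : X} (hz : z ∈ B) : g z ≤ glue B u g z := by
  unfold glue
  rw [if_pos hz]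
  exact le_max_right _ _

theorem glue_eq_or (z : X) :
    glue B u g z = u z ∨ (z ∈ B ∧ u z < g z ∧ glue B u g z = g z) := by
  unfold glue
  split_ifs with h
  · rcases le_or_gt (g z) (u z) with h' | h'
    · exact Or.inl (max_eq_left h')
    · exact Or.inr ⟨h, h', max_eq_right h'.le⟩
  · exact Or.inl rfl

theorem upperSemicontinuousOn_glue [TopologicalSpace X] {K : Set X} {u g : X → ℝ}
    (hu : UpperSemicontinuousOn u K) (hB : IsClosed B) (hg : UpperSemicontinuousOn g (B ∩ K)) :
    UpperSemicontinuousOn (glue B u g) K := by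
  intro x hx
  refine upperSemicontinuousWithinAt_iff.2 fun y hy => ?_
  have hu' := upperSemicontinuousWithinAt_iff.1 (hu x hx) y ((le_glue u g B x).trans_lt hy)
  have hg' : ∀ᶠ z in 𝓝[K] x, z ∈ B → g z < y := by
    by_cases hxB : x ∈ B
    · have := upperSemicontinuousWithinAt_iff.1 (hg x ⟨hxB, hx⟩) y
        ((le_glue_of_mem u g hxB).trans_lt hy)
      rw [eventually_nhdsWithin_iff] at this ⊢
      filter_upwards [this] with z hz hzK hzB using hz ⟨hzB, hzK⟩
    · filter_upwards [mem_nhdsWithin_of_mem_nhds (hB.isOpen_compl.mem_nhds hxB)] with z hz hzB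
      exact absurd hzB hz
  filter_upwards [hu', hg'] with z hzu hzg
  rcases glue_eq_or (B := B) u g z with h | ⟨hzB, -, h⟩
  · rwa [h]
  · rw [h]
    exact hzg hzB

end Glue

section Subharmonicity

variable {E : Type*} [NormedAddCommGroup E] [NormedSpace ℝ E]
  {X : Type*} [TopologicalSpace X] [ChartedSpace E X] {F : Set (Jet2 E X)}

theorem IsSubharmonicAt.of_eventually_le {u v : X → ℝ} {x : X} (hu : IsSubharmonicAt F u x)
    (hle : ∀ᶠ z in 𝓝 x, u z ≤ v z) (heq : u x = v x) : IsSubharmonicAt F v x :=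
  fun ψ hψ hψle hψeq => hu ψ hψ (hle.mp (hψle.mono fun _ hvψ huv => huv.trans hvψ)) (heq.trans hψeq)

theorem isSubharmonicOn_coe {Ω : Set X} {u : X → ℝ} (hu : ContinuousOn u Ω)
    (hsub : ∀ x ∈ Ω, IsSubharmonicAt F u x) : IsSubharmonicOn F Ω fun x => (u x : EReal) := by
  refine ⟨(continuous_coe_real_ereal.comp_continuousOn hu).upperSemicontinuousOn,
    fun _ _ => EReal.coe_lt_top _, fun x hx ψ hψ hle heq => ?_⟩
  exact hsub x hx ψ hψ (hle.mono fun z hz => EReal.coe_le_coe_iff.1 hz)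
    (EReal.coe_eq_coe_iff.1 heq)

variable [IsManifold 𝓘(ℝ, E) 2 X]

theorem IsPositive.isSubharmonicAt (hF : IsPositive F) {g : X → ℝ} {x : X}
    (hg : ContMDiffAt 𝓘(ℝ, E) 𝓘(ℝ, ℝ) 2 g x) (hgF : jet2 g x ∈ F) : IsSubharmonicAt F g x :=
  fun _ hψ hle heq => hF.jet2_mem_of_eventually_le hg hψ hle heq hgF

theorem IsSubharmonicAt.sub_const (hF : IsNegative F) {u : X → ℝ} {x : X}
    (hu : IsSubharmonicAt F u x) {ε : ℝ} (hε : 0 ≤ ε) :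
    IsSubharmonicAt F (fun z => u z - ε) x := by
  intro ψ hψ hle heq
  have hψε : jet2 (fun z => ε + 1 * ψ z) x ∈ F :=
    hu _ (contMDiffAt_const.add (contMDiffAt_const.mul hψ))
      (hle.mono fun z hz => by linarith) (by linarith)
  have hshift := jet2_const_add_mul 0 1 hψ
  rw [jet2_const_add_mul ε 1 hψ] at hψε
  simp only [one_mul, zero_add] at hψε hshift
  exact hshift ▸ hF.withValue_mem (by linarith) hψε

variable {F' : Set (Jet2 E X)} {Ω B : Set X} {x : X} {h : X → ℝ} {t₀ t c : ℝ}

theorem IsBarrier.isSubharmonicAt (hb : IsBarrier F c Ω x B h t₀) (hpos : IsPositive F)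
    (hneg : IsNegative F) (ht : t₀ ≤ t) {z : X} (hz : z ∈ B) (hzΩ : z ∈ closure Ω) :
    IsSubharmonicAt F (fun y => c + t * h y) z := by
  refine hpos.isSubharmonicAt (contMDiffAt_const.add (contMDiffAt_const.mul (hb.contMDiffAt z hz)))
    ?_
  rw [jet2_const_add_mul c t (hb.contMDiffAt z hz)]
  have hle : t * h z ≤ 0 :=
    mul_nonpos_of_nonneg_of_nonpos (hb.t₀_pos.le.trans ht) (hb.nonpos hz hzΩ)
  have hmem : (redJet2 h z).scale t ∈ fixValue F c := interior_subset (hb.scale_mem t ht z hz)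
  exact hneg.withValue_mem (add_le_of_nonpos_right hle) hmem

theorem IsBarrier.add_mul_le (hb : IsBarrier F' (-c) Ω x B h t₀) (hopp : Opposed F F')
    (hneg : IsNegative F') (hΩ : IsOpen Ω) (ht : t₀ ≤ t) {u : X → ℝ}
    (husc : UpperSemicontinuousOn u (closure Ω)) (hfr : ∀ z ∈ B ∩ frontier Ω, u z ≤ c)
    (hside : ∀ z ∈ (B \ interior B) ∩ closure Ω, u z + t * h z ≤ c)
    (hsub : ∀ z ∈ Ω, c < u z → IsSubharmonicAt F u z) :
    ∀ z ∈ B ∩ closure Ω, u z + t * h z ≤ c := by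
  have hth : ∀ z ∈ B ∩ closure Ω, t * h z ≤ 0 := fun z hz =>
    mul_nonpos_of_nonneg_of_nonpos (hb.t₀_pos.le.trans ht) (hb.nonpos hz.1 hz.2)
  have hvusc : UpperSemicontinuousOn (fun y => u y + t * h y) (B ∩ closure Ω) :=
    (husc.mono inter_subset_right).add
      ((hb.continuousOn.mono inter_subset_left).const_mul t).upperSemicontinuousOn
  by_contra! ⟨z, hz, hzc⟩
  have hbdry : ∀ y ∈ (B ∩ closure Ω) \ (interior B ∩ Ω), u y + t * h y ≤ c := by
    rintro y ⟨hy, hyO⟩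
    by_cases hyB : y ∈ interior B
    · have hyf : y ∈ frontier Ω := hΩ.frontier_eq ▸ ⟨hy.2, fun hyΩ => hyO ⟨hyB, hyΩ⟩⟩
      linarith [hfr y ⟨hy.1, hyf⟩, hth y hy]
    · exact hside y ⟨⟨hy.1, hyB⟩, hy.2⟩
  obtain ⟨w, hw, hmax, hzw⟩ := exists_isLocalMax_mem_open
    (hb.compact.inter_right isClosed_closure) (isOpen_interior.inter hΩ)
    (inter_subset_inter interior_subset subset_closure) hvusc hz
    fun y hy => (hbdry y hy).trans_lt hzc
  have hwB : w ∈ B := interior_subset hw.1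
  have hcw : c < u w := by linarith [hth w ⟨hwB, subset_closure hw.2⟩]
  have := hb.le_of_isLocalMax hopp hneg ht hwB (hsub w hw.2 hcw) hmax
  linarith

end Subharmonicity

section Bump

variable {E : Type*} [NormedAddCommGroup E] [NormedSpace ℝ E] [FiniteDimensional ℝ E]
  {X : Type*} [TopologicalSpace X] [ChartedSpace E X] [IsManifold 𝓘(ℝ, E) 2 X]

theorem exists_strict_perturbation {F : Set (Jet2 E X)} (hF : IsClosed F) {ψ : X → ℝ}
    {x : X} (hψ : ContMDiffAt 𝓘(ℝ, E) 𝓘(ℝ, ℝ) 2 ψ x) (hψF : jet2 ψ x ∉ F)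
    {O : Set X} (hO : O ∈ 𝓝 x) :
    ∃ B ⊆ O, IsCompact B ∧ B ∈ 𝓝 x ∧ ∃ f : X → ℝ, f x = ψ x ∧
      (∀ z ∈ B, ContMDiffAt 𝓘(ℝ, E) 𝓘(ℝ, ℝ) 2 f z) ∧ (∀ z, ψ z ≤ f z) ∧
      ∃ δ > 0, (∀ z ∈ B \ interior B, ψ z + δ ≤ f z) ∧
        ∀ z ∈ B, ∀ s, |s| ≤ δ → jet2 (fun y => s + f y) z ∉ F := by
  obtain ⟨B, hBO, hBc, hBn, hBs, δ₀, hδ₀, hjet⟩ :=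
    exists_perturbation hψ hO (hF.isOpen_compl.mem_nhds hψF)
  obtain ⟨μ, hμ, hle⟩ := exists_chartDistSq_ge (E := E) hBc hBn hBs
  have hd : 0 < δ₀ / 2 := half_pos hδ₀
  refine ⟨B, hBO, hBc, hBn, fun y => ψ y + δ₀ / 2 * chartDistSq (E := E) x y,
    by simp only [chartDistSq_self, mul_zero, add_zero], fun z hz => (hjet z hz _).1,
    fun z => le_add_of_nonneg_right (mul_nonneg hd.le (sq_nonneg _)),
    min (δ₀ / 2) (δ₀ / 2 * μ), lt_min hd (mul_pos hd hμ), fun z hz => ?_, fun z hz s hs => ?_⟩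
  · linarith [min_le_right (δ₀ / 2) (δ₀ / 2 * μ), mul_le_mul_of_nonneg_left (hle z hz) hd.le]
  · exact (hjet z hz _).2 (by rw [abs_of_pos hd]; exact half_lt_self hδ₀) s
      ((hs.trans (min_le_left _ _)).trans_lt (half_lt_self hδ₀))

theorem isSubharmonicAt_uscSup {F : Set (Jet2 E X)} (hF : IsClosed F) {K : Set X}
    {S : Set (X → ℝ)} (hS : S.Nonempty) {C : ℝ} (hC : ∀ u ∈ S, ∀ x ∈ K, u x ≤ C)
    (husc : ∀ u ∈ S, UpperSemicontinuousOn u K) {O : Set X} {x : X} (hO : O ∈ 𝓝 x) (hOK : O ⊆ K)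
    {q : ℝ} (hsub : ∀ u ∈ S, ∀ z ∈ O, q < u z → IsSubharmonicAt F u z) (hq : q < uscSup K S x) :
    IsSubharmonicAt F (uscSup K S) x := by
  intro ψ hψ hle heq
  by_contra hψF
  obtain ⟨q', hqq', hq'⟩ := exists_between hq
  have hO' : {z | z ∈ O ∧ uscSup K S z ≤ ψ z ∧ q' < ψ z} ∈ 𝓝 x :=
    inter_mem hO (inter_mem hle (hψ.continuousAt.eventually (lt_mem_nhds (heq ▸ hq'))))
  obtain ⟨B, hBO, hBc, hBn, f, hfx, hf, hψf, δ, hδ, hfδ, hfF⟩ :=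
    exists_strict_perturbation hF hψ hψF hO'
  have hBK : B ⊆ K := fun z hz => hOK (hBO hz).1
  have huψ : ∀ u ∈ S, ∀ z ∈ B, u z ≤ ψ z := fun u hu z hz =>
    (le_uscSup hC hu (hBK hz)).trans (hBO hz).2.1
  obtain ⟨τ, hτ, hτδ, hτq⟩ : ∃ τ > 0, 2 * τ < δ ∧ 2 * τ < q' - q :=
    ⟨min δ (q' - q) / 3, div_pos (lt_min hδ (sub_pos.2 hqq')) three_pos,
      by linarith [min_le_left δ (q' - q)], by linarith [min_le_right δ (q' - q)]⟩
  have hfτ : ∀ᶠ z in 𝓝 x, f z < uscSup K S x + τ :=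
    (hf x (mem_of_mem_nhds hBn)).continuousAt.eventually (gt_mem_nhds (by linarith))
  obtain ⟨z, ⟨u, hu, hzu⟩, hzB, hzf⟩ := ((frequently_exists_lt_of_lt_uscSup hS
    (hBK (mem_of_mem_nhds hBn)) (sub_lt_self _ hτ)).and_eventually
      (mem_nhdsWithin_of_mem_nhds (inter_mem hBn hfτ))).exists
  have hzf' : f z < uscSup K S x + τ := hzf
  have hfc : ContinuousOn f B := fun y hy => (hf y hy).continuousAt.continuousWithinAt
  obtain ⟨w, hwB, hmax, hzw⟩ := exists_isLocalMax_mem_open (v := fun y => u y + -f y) hBc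
    isOpen_interior interior_subset
    (((husc u hu).mono hBK).add hfc.neg.upperSemicontinuousOn) hzB
    fun y hy => by linarith [hfδ y hy, huψ u hu y hy.1]
  have hwB' := interior_subset hwB
  have hqw : q < u w := by linarith [(hBO hwB').2.2, hψf w]
  refine hfF w hwB' (u w + -f w) (abs_le.2 ⟨by linarith, by linarith [huψ u hu w hwB', hψf w]⟩) ?_
  exact hsub u hu w (hBO hwB').1 hqw _ (contMDiffAt_const.add (hf w hwB'))
    (hmax.mono fun y hy => by linarith) (by ring)

end Bump

section Perron

variable {E : Type*} [NormedAddCommGroup E] [NormedSpace ℝ E]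
  {X : Type*} [TopologicalSpace X] [ChartedSpace E X]

/-- The competitors in the Perron method with boundary data `φ`, truncated below at `-k`: at the
points where they equal `-k` they need not be subharmonic. -/
structure IsCompetitor (F : Set (Jet2 E X)) (Ω : Set X) (φ : X → ℝ) (k : ℝ) (u : X → ℝ) :
    Prop where
  lower : ∀ x ∈ closure Ω, -k ≤ u x
  usc : UpperSemicontinuousOn u (closure Ω)
  boundary : ∀ x ∈ frontier Ω, u x ≤ φ x
  sub : ∀ x ∈ Ω, -k < u x → IsSubharmonicAt F u x

/-- The Perron function: the upper semicontinuous regularization of the supremum of all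
competitors. -/
def perron (F : Set (Jet2 E X)) (Ω : Set X) (φ : X → ℝ) (k : ℝ) : X → ℝ :=
  uscSup (closure Ω) {u | IsCompetitor F Ω φ k u}

/-- A competitor which is at least as large as every other one. The Perron function is shown to be
one, and its regularity is derived from this property alone. -/
structure IsLargestCompetitor (F : Set (Jet2 E X)) (Ω : Set X) (φ : X → ℝ) (k : ℝ) (U : X → ℝ) :
    Prop extends IsCompetitor F Ω φ k U where
  le : ∀ u, IsCompetitor F Ω φ k u → ∀ x ∈ closure Ω, u x ≤ U x

variable {F F' : Set (Jet2 E X)} {Ω : Set X} {φ : X → ℝ} {k : ℝ}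

theorem isCompetitor_const (hφ : ∀ x ∈ frontier Ω, -k ≤ φ x) :
    IsCompetitor F Ω φ k fun _ => -k where
  lower _ _ := le_rfl
  usc := upperSemicontinuousOn_const
  boundary := hφ
  sub _ _ h := absurd h (lt_irrefl _)

theorem IsCompetitor.glue {u g : X → ℝ} (hu : IsCompetitor F Ω φ k u) {B : Set X}
    (hB : IsClosed B) (hg : UpperSemicontinuousOn g (B ∩ closure Ω))
    (hφ : ∀ x ∈ frontier Ω, x ∈ B → u x < g x → g x ≤ φ x)
    (hsub : ∀ x ∈ Ω, x ∈ B → u x < g x → B ∈ 𝓝 x ∧ IsSubharmonicAt F g x) :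
    IsCompetitor F Ω φ k (glue B u g) where
  lower x hx := (hu.lower x hx).trans (le_glue u g B x)
  usc := upperSemicontinuousOn_glue hu.usc hB hg
  boundary x hx := by
    rcases glue_eq_or (B := B) u g x with h | ⟨hxB, hlt, h⟩ <;> rw [h]
    · exact hu.boundary x hx
    · exact hφ x hx hxB hlt
  sub x hx hk := by
    rcases glue_eq_or (B := B) u g x with h | ⟨hxB, hlt, h⟩
    · exact (hu.sub x hx (h ▸ hk)).of_eventually_le (Eventually.of_forall (le_glue u g B)) h.symm
    · obtain ⟨hBx, hgx⟩ := hsub x hx hxB hlt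
      exact hgx.of_eventually_le (mem_of_superset hBx fun z hz => le_glue_of_mem u g hz) h.symm

section BoundaryBehaviour

variable [FiniteDimensional ℝ E] [IsManifold 𝓘(ℝ, E) 2 X] {x : X} {ε C : ℝ}

theorem eventually_competitor_le (hopp : Opposed F F') (hneg : IsNegative F') (hΩ : IsOpen Ω)
    (hconv : HasStrictlyConvexBoundary F' Ω) (hφ : ContinuousOn φ (frontier Ω))
    (hC : ∀ u, IsCompetitor F Ω φ k u → ∀ x ∈ closure Ω, u x ≤ C)
    (hx : x ∈ frontier Ω) (hk : -k ≤ φ x) (hε : 0 < ε) :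
    ∀ᶠ z in 𝓝[closure Ω] x, ∀ u, IsCompetitor F Ω φ k u → u z ≤ φ x + ε := by
  set c := φ x + ε / 2 with hc
  have hO : {z | z ∈ frontier Ω → φ z < c} ∈ 𝓝 x :=
    eventually_nhdsWithin_iff.1 ((hφ x hx).eventually (gt_mem_nhds (by linarith)))
  obtain ⟨B, hBO, h, t₀, hb⟩ := (hconv x hx (-c)).exists_isBarrier hx hO
  obtain ⟨t, ht, hside⟩ := hb.exists_scale_le (C - c)
  have hmain : ∀ u, IsCompetitor F Ω φ k u → ∀ z ∈ B ∩ closure Ω, u z + t * h z ≤ c :=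
    fun u hu => hb.add_mul_le hopp hneg hΩ ht hu.usc
      (fun z hz => (hu.boundary z hz.2).trans (hBO hz.1 hz.2).le)
      (fun z hz => by linarith [hside z hz, hC u hu z hz.2])
      fun z hz hcz => hu.sub z hz (by linarith)
  have hlow : ∀ᶠ z in 𝓝 x, -(ε / 2) < t * h z := by
    refine ((hb.contMDiffAt x (mem_of_mem_nhds hb.mem_nhds)).continuousAt.const_mul t).eventually
      (lt_mem_nhds ?_)
    simpa only [hb.eq_zero, mul_zero, neg_neg_iff_pos] using half_pos hε
  filter_upwards [mem_nhdsWithin_of_mem_nhds hb.mem_nhds, self_mem_nhdsWithin,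
    mem_nhdsWithin_of_mem_nhds hlow] with z hzB hzΩ hz u hu
  have hz' : -(ε / 2) < t * h z := hz
  linarith [hmain u hu z ⟨hzB, hzΩ⟩, hz']

theorem isLargestCompetitor_perron (hF : IsClosed F) (hopp : Opposed F F') (hneg : IsNegative F')
    (hΩ : IsOpen Ω) (hconv : HasStrictlyConvexBoundary F' Ω) (hφ : ContinuousOn φ (frontier Ω))
    (hC : ∀ u, IsCompetitor F Ω φ k u → ∀ x ∈ closure Ω, u x ≤ C)
    (hk : ∀ x ∈ frontier Ω, -k ≤ φ x) : IsLargestCompetitor F Ω φ k (perron F Ω φ k) := by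
  have hne : {u | IsCompetitor F Ω φ k u}.Nonempty := ⟨_, isCompetitor_const hk⟩
  have hle : ∀ u, IsCompetitor F Ω φ k u → ∀ x ∈ closure Ω, u x ≤ perron F Ω φ k x :=
    fun u hu x hx => le_uscSup hC hu hx
  refine ⟨⟨hle _ (isCompetitor_const hk), upperSemicontinuousOn_uscSup hne hC, ?_, ?_⟩, hle⟩
  · intro x hx
    refine le_of_forall_pos_le_add fun ε hε => uscSup_le hne (frontier_subset_closure hx) ?_
    exact eventually_competitor_le hopp hneg hΩ hconv hφ hC hx (hk x hx) hε
  · exact fun x hx hkx => isSubharmonicAt_uscSup hF hne hC (fun u hu => hu.usc) (hΩ.mem_nhds hx)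
      subset_closure (fun u hu => hu.sub) hkx

variable [T2Space X]

theorem exists_competitor_ge (hpos : IsPositive F) (hneg : IsNegative F)
    (hconv : HasStrictlyConvexBoundary F Ω) (hφ : ContinuousOn φ (frontier Ω))
    (hk : ∀ x ∈ frontier Ω, -k ≤ φ x) (hx : x ∈ frontier Ω) (hε : 0 < ε) :
    ∃ u, IsCompetitor F Ω φ k u ∧ ∀ᶠ z in 𝓝[closure Ω] x, φ x - ε ≤ u z := by
  obtain ⟨c, hεc, hcφ⟩ := exists_between (sub_lt_self (φ x) hε)
  have hO : {z | z ∈ frontier Ω → c < φ z} ∈ 𝓝 x :=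
    eventually_nhdsWithin_iff.1 ((hφ x hx).eventually (lt_mem_nhds hcφ))
  obtain ⟨B, hBO, h, t₀, hb⟩ := (hconv x hx c).exists_isBarrier hx hO
  obtain ⟨t, ht, hside⟩ := hb.exists_scale_le (c + k)
  have hcont : ∀ z ∈ B, ContinuousAt (fun y => c + t * h y) z := fun z hz =>
    continuousAt_const.add ((hb.contMDiffAt z hz).continuousAt.const_mul t)
  refine ⟨glue B (fun _ => -k) fun y => c + t * h y,
    (isCompetitor_const hk).glue hb.compact.isClosed ?_ ?_ ?_, ?_⟩
  · exact ContinuousOn.upperSemicontinuousOn fun z hz => (hcont z hz.1).continuousWithinAt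
  · intro z hz hzB _
    have hle : t * h z ≤ 0 := mul_nonpos_of_nonneg_of_nonpos (hb.t₀_pos.le.trans ht)
      (hb.nonpos hzB (frontier_subset_closure hz))
    linarith [hBO hzB hz]
  · intro z hz hzB hlt
    refine ⟨?_, hb.isSubharmonicAt hpos hneg ht hzB (subset_closure hz)⟩
    by_contra hzB'
    linarith [hside z ⟨⟨hzB, mt mem_interior_iff_mem_nhds.1 hzB'⟩, subset_closure hz⟩]
  · have hlow : ∀ᶠ z in 𝓝 x, φ x - ε < c + t * h z := by
      refine (hcont x (mem_of_mem_nhds hb.mem_nhds)).eventually (lt_mem_nhds ?_)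
      simpa only [hb.eq_zero, mul_zero, add_zero] using hεc
    filter_upwards [mem_nhdsWithin_of_mem_nhds hlow, mem_nhdsWithin_of_mem_nhds hb.mem_nhds]
      with z hz hzB
    exact (le_of_lt hz).trans (le_glue_of_mem (fun _ => -k) (fun y => c + t * h y) hzB)

namespace IsLargestCompetitor

variable {U : X → ℝ}

theorem eventually_sub_le (hU : IsLargestCompetitor F Ω φ k U) (hpos : IsPositive F)
    (hneg : IsNegative F) (hconv : HasStrictlyConvexBoundary F Ω)
    (hφ : ContinuousOn φ (frontier Ω)) (hk : ∀ x ∈ frontier Ω, -k ≤ φ x)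
    (hx : x ∈ frontier Ω) (hε : 0 < ε) : ∀ᶠ z in 𝓝[closure Ω] x, φ x - ε ≤ U z := by
  obtain ⟨u, hu, hφu⟩ := exists_competitor_ge hpos hneg hconv hφ hk hx hε
  filter_upwards [hφu, self_mem_nhdsWithin] with z hz hzΩ using hz.trans (hU.le u hu z hzΩ)

theorem eq_boundary (hU : IsLargestCompetitor F Ω φ k U) (hpos : IsPositive F)
    (hneg : IsNegative F) (hconv : HasStrictlyConvexBoundary F Ω)
    (hφ : ContinuousOn φ (frontier Ω)) (hk : ∀ x ∈ frontier Ω, -k ≤ φ x)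
    (hx : x ∈ frontier Ω) : U x = φ x := by
  refine le_antisymm (hU.boundary x hx) (le_of_forall_pos_le_add fun ε hε => ?_)
  exact sub_le_iff_le_add.1 ((hU.eventually_sub_le hpos hneg hconv hφ hk hx hε).self_of_nhdsWithin
    (frontier_subset_closure hx))

theorem continuousWithinAt_of_mem_frontier (hU : IsLargestCompetitor F Ω φ k U)
    (hpos : IsPositive F) (hneg : IsNegative F) (hconv : HasStrictlyConvexBoundary F Ω)
    (hφ : ContinuousOn φ (frontier Ω)) (hk : ∀ x ∈ frontier Ω, -k ≤ φ x)
    (hx : x ∈ frontier Ω) : ContinuousWithinAt U (closure Ω) x := by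
  refine tendsto_order.2 ⟨fun y hy => ?_, fun y hy => hU.usc x (frontier_subset_closure hx) y hy⟩
  rw [hU.eq_boundary hpos hneg hconv hφ hk hx] at hy
  filter_upwards [hU.eventually_sub_le hpos hneg hconv hφ hk hx (half_pos (sub_pos.2 hy))] with z hz
  linarith

theorem isSubharmonicAt_dual (hU : IsLargestCompetitor F Ω φ k U) (hpos : IsPositive F)
    (hΩ : IsOpen Ω) (hx : x ∈ Ω) : IsSubharmonicAt (dual F) (fun z => -U z) x := by
  intro ψ hψ hle heq
  by_contra hψF
  obtain ⟨B, hBO, hBc, hBn, f, hfx, hf, -, δ, hδ, hfδ, hfF⟩ :=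
    exists_strict_perturbation (isClosed_dual F) hψ hψF (inter_mem (hΩ.mem_nhds hx) hle)
  have hg : ∀ z ∈ B, ContMDiffAt 𝓘(ℝ, E) 𝓘(ℝ, ℝ) 2 (fun y => -(-δ + f y)) z := fun z hz =>
    (contMDiffAt_const.add (hf z hz)).neg
  have hbump : IsCompetitor F Ω φ k (glue B U fun y => -(-δ + f y)) := by
    refine hU.glue hBc.isClosed ?_ ?_ ?_
    · exact ContinuousOn.upperSemicontinuousOn fun z hz =>
        (hg z hz.1).continuousAt.continuousWithinAt
    · exact fun z hz hzB => absurd (hBO hzB).1 (hΩ.frontier_eq ▸ hz).2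
    · intro z _ hzB hlt
      refine ⟨?_, hpos.isSubharmonicAt (hg z hzB) ?_⟩
      · by_contra hzB'
        have hUψ : -U z ≤ ψ z := (hBO hzB).2
        linarith [hfδ z ⟨hzB, mt mem_interior_iff_mem_nhds.1 hzB'⟩]
      · have hf' : ContMDiffAt 𝓘(ℝ, E) 𝓘(ℝ, ℝ) 2 (fun y => -δ + f y) z :=
          contMDiffAt_const.add (hf z hzB)
        rw [jet2_neg hf']
        exact interior_subset (not_not.1 (hfF z hzB (-δ) (by rw [abs_neg, abs_of_pos hδ])))
  have hUx := hU.le _ hbump x (subset_closure hx)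
  have hgx := le_glue_of_mem U (fun y => -(-δ + f y)) (mem_of_mem_nhds hBn)
  linarith

end IsLargestCompetitor

end BoundaryBehaviour

end Perron

section Continuity

variable {G : Type*} [Group G] [TopologicalSpace G] {X : Type*} [TopologicalSpace X] [MulAction G X]
  [ContinuousSMul G X]

theorem eventually_forall_dist_smul_lt {Y : Type*} [PseudoMetricSpace Y] {K T : Set X}
    (hT : IsCompact T) (hTK : T ⊆ K) {U : X → Y} (hU : ∀ y ∈ T, ContinuousWithinAt U K y) {ε : ℝ}
    (hε : 0 < ε) : ∀ᶠ a : G in 𝓝 1, ∀ y ∈ T, a • y ∈ K → dist (U (a • y)) (U y) < ε := by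
  suffices ∀ᶠ a : G in 𝓝 1, ∀ y ∈ T, y ∈ K → a • y ∈ K → dist (U (a • y)) (U y) < ε from
    this.mono fun a ha y hy => ha y hy (hTK hy)
  refine hT.eventually_forall_of_forall_eventually fun y hy => ?_
  have hW : ∀ᶠ z in 𝓝 y, z ∈ K → dist (U z) (U y) < ε / 2 :=
    eventually_nhdsWithin_iff.1 ((hU y hy).eventually (Metric.ball_mem_nhds _ (half_pos hε)))
  have hsmul : Tendsto (fun q : G × X => q.1 • q.2) (𝓝 (1, y)) (𝓝 y) := by
    simpa only [one_smul] using (continuous_smul (M := G) (X := X)).tendsto (1, y)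
  have hsnd : Tendsto (fun q : G × X => q.2) (𝓝 (1, y)) (𝓝 y) := continuousAt_snd
  filter_upwards [hsnd.eventually hW, hsmul.eventually hW] with q hq hqsmul hqK hqsmulK
  linarith [dist_triangle_right (U (q.1 • q.2)) (U q.2) (U y), hq hqK, hqsmul hqsmulK]

variable [IsTopologicalGroup G] {E : Type*} [NormedAddCommGroup E] [NormedSpace ℝ E]
  [ChartedSpace E X] [IsManifold 𝓘(ℝ, E) 2 X]
  {F : Set (Jet2 E X)} {Ω : Set X} {φ : X → ℝ} {k : ℝ} {U : X → ℝ}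

namespace IsLargestCompetitor

theorem eventually_smul_sub_le (hU : IsLargestCompetitor F Ω φ k U) (hF : IsNegative F)
    (hinv : IsJetInvariant G F)
    (hsm : ∀ a : G, ContMDiff 𝓘(ℝ, E) 𝓘(ℝ, E) 2 (fun z : X => a • z))
    (hΩ : IsOpen Ω) (hcpt : IsCompact (closure Ω))
    (hbdry : ∀ x ∈ frontier Ω, ContinuousWithinAt U (closure Ω) x) {ε : ℝ} (hε : 0 < ε) :
    ∀ᶠ a : G in 𝓝 1, ∀ x ∈ closure Ω, a • x ∈ closure Ω → U (a • x) - ε ≤ U x := by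
  have hnear : ∀ᶠ a : G in 𝓝 1, ∀ y ∈ frontier Ω, a • y ∈ closure Ω →
      dist (U (a • y)) (U y) < ε :=
    eventually_forall_dist_smul_lt (hcpt.of_isClosed_subset isClosed_frontier
      frontier_subset_closure) frontier_subset_closure hbdry hε
  have hnear' := (continuous_inv (G := G)).tendsto 1
  rw [inv_one] at hnear'
  filter_upwards [hnear, hnear'.eventually hnear] with a ha ha'
  have hac : Continuous fun z : X => a • z := (hsm a).continuous
  have htranslate : IsCompetitor F Ω φ k
      (glue {x | a • x ∈ closure Ω} U fun x => U (a • x) - ε) := by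
    refine hU.glue (isClosed_closure.preimage hac) ?_ ?_ ?_
    · simp only [sub_eq_add_neg]
      exact (hU.usc.comp hac.continuousOn fun z hz => hz.1).add upperSemicontinuousOn_const
    · intro x hx hax hlt
      linarith [(abs_lt.1 (ha x hx hax)).2]
    · intro x hx hax hlt
      have haΩ : a • x ∈ Ω := by
        by_contra haΩ
        have hxcl : a⁻¹ • a • x ∈ closure Ω := (inv_smul_smul a x).symm ▸ subset_closure hx
        have hdist := ha' (a • x) (hΩ.frontier_eq ▸ ⟨hax, haΩ⟩) hxcl
        rw [inv_smul_smul] at hdist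
        linarith [(abs_lt.1 hdist).1]
      have hk : -k < U (a • x) := by linarith [hU.lower x (subset_closure hx)]
      exact ⟨mem_of_superset ((hΩ.preimage hac).mem_nhds haΩ) fun z hz => subset_closure hz,
        ((hU.sub _ haΩ hk).comp_smul hinv hsm).sub_const hF hε.le⟩
  intro x hx hax
  have hle : U (a • x) - ε ≤ glue {x | a • x ∈ closure Ω} U _ x :=
    le_glue_of_mem U (fun x => U (a • x) - ε) (B := {x | a • x ∈ closure Ω}) hax
  exact hle.trans (hU.le _ htranslate x hx)

theorem continuousOn (hU : IsLargestCompetitor F Ω φ k U) (hF : IsNegative F)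
    (hinv : IsJetInvariant G F)
    (hsm : ∀ a : G, ContMDiff 𝓘(ℝ, E) 𝓘(ℝ, E) 2 (fun z : X => a • z))
    (horb : ∀ x : X, IsOpenMap fun a : G => a • x) (hΩ : IsOpen Ω) (hcpt : IsCompact (closure Ω))
    (hbdry : ∀ x ∈ frontier Ω, ContinuousWithinAt U (closure Ω) x) :
    ContinuousOn U (closure Ω) := by
  intro x hx
  refine tendsto_order.2 ⟨fun y hy => ?_, fun y hy => hU.usc x hx y hy⟩
  have hnear := hU.eventually_smul_sub_le hF hinv hsm hΩ hcpt hbdry (half_pos (sub_pos.2 hy))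
  have himage := (horb x).image_mem_nhds (inv_mem_nhds_one G hnear)
  rw [one_smul] at himage
  filter_upwards [mem_nhdsWithin_of_mem_nhds himage, self_mem_nhdsWithin]
  rintro _ ⟨b, hb, rfl⟩ hbx
  have hle : U (b⁻¹ • b • x) - (U x - y) / 2 ≤ U (b • x) :=
    hb (b • x) hbx ((inv_smul_smul b x).symm ▸ hx)
  rw [inv_smul_smul] at hle
  change y < U (b • x)
  linarith

end IsLargestCompetitor

end Continuity

section Existence

variable {E : Type*} [NormedAddCommGroup E] [NormedSpace ℝ E] [FiniteDimensional ℝ E]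
  {X : Type*} [TopologicalSpace X] [T2Space X] [ChartedSpace E X] [IsManifold 𝓘(ℝ, E) 2 X]
  {F : Set (Jet2 E X)} {Ω : Set X} {φ : X → ℝ} {k : ℝ} {U : X → ℝ}

theorem IsLargestCompetitor.isHarmonicOn (hU : IsLargestCompetitor F Ω φ k U) (hF : IsPositive F)
    (hΩ : IsOpen Ω) (hcont : ContinuousOn U Ω) (hlow : ∀ x ∈ Ω, -k < U x) : IsHarmonicOn F Ω U :=
  ⟨isSubharmonicOn_coe hcont fun x hx => hU.sub x hx (hlow x hx),
    isSubharmonicOn_coe hcont.neg fun _ hx => hU.isSubharmonicAt_dual hF hΩ hx⟩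

end Existence

end JetDirichlet

end

theorem isOpenMap_smul_quotient {G : Type*} [Group G] [TopologicalSpace G] [IsTopologicalGroup G]
    {H : Subgroup G} (x : G ⧸ H) : IsOpenMap fun a : G => a • x := by
  obtain ⟨b, rfl⟩ := QuotientGroup.mk_surjective x
  exact QuotientGroup.isOpenMap_coe.comp (isOpenMap_mul_right b)

open JetDirichlet in
theorem theorem8p1p3_general
    {G : Type*} [Group G] [TopologicalSpace G] [IsTopologicalGroup G] [LocallyConnectedSpace G]
    {E : Type*} [NormedAddCommGroup E] [NormedSpace ℝ E] [FiniteDimensional ℝ E]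
    {X : Type*} [TopologicalSpace X] [T2Space X] [ChartedSpace E X] [IsManifold 𝓘(ℝ, E) 2 X]
    [MulAction G X] [ContinuousSMul G X]
    (hsm : ∀ a : G, ContMDiff 𝓘(ℝ, E) 𝓘(ℝ, E) 2 (fun z : X => a • z))
    (horb : ∀ x : X, IsOpenMap fun a : G => a • x)
    {F : Set (Jet2 E X)} (hF : IsSubequation F) (hinv : IsJetInvariant G F)
    {Ω : Set X} (hopen : IsOpen Ω) (hconn : IsPreconnected Ω)
    (hcpt : IsCompact (closure Ω)) (hbdry : (frontier Ω).Nonempty)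
    (hconv : HasStrictlyConvexBoundary F Ω) (hconv' : HasStrictlyConvexBoundary (dual F) Ω) :
    DirichletExistence F Ω := by
  intro φ hφ
  have hpos : IsPositive F := hF.positivity
  have hneg : IsNegative F := hF.negativity
  have hopp : Opposed F (dual F) := opposed_dual_right hF.eq_closure_interior.subset
  obtain ⟨m, hm⟩ := (hcpt.of_isClosed_subset isClosed_frontier
    frontier_subset_closure).exists_bound_of_continuousOn hφ
  have hφm : ∀ x ∈ frontier Ω, -m ≤ φ x ∧ φ x ≤ m := fun x hx => abs_le.1 (hm x hx)
  obtain ⟨C, hC⟩ := exists_upper_bound hopp hneg.dual hinv hsm horb hopen hconn hcpt hbdry hconv' m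
  obtain ⟨C', hC'⟩ := exists_upper_bound (opposed_dual_left F) hneg
    (hinv.dual hF.interior_fibre hsm) hsm horb hopen hconn hcpt hbdry hconv m
  obtain ⟨k, hk⟩ := exists_gt (max |m| C')
  obtain ⟨hmk, hCk⟩ := max_lt_iff.1 hk
  have hφk : ∀ x ∈ frontier Ω, -k ≤ φ x := fun x hx => by
    linarith [(hφm x hx).1, le_abs_self m]
  have hU := isLargestCompetitor_perron hF.isClosed hopp hneg.dual hopen hconv' hφ
    (fun u hu => hC u hu.usc (fun x hx => (hu.boundary x hx).trans (hφm x hx).2)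
      fun x hx hmx => hu.sub x hx (by linarith [neg_abs_le m])) hφk
  have hUφ : ∀ x ∈ frontier Ω, perron F Ω φ k x = φ x := fun x hx =>
    hU.eq_boundary hpos hneg hconv hφ hφk hx
  have hcont : ContinuousOn (perron F Ω φ k) (closure Ω) :=
    hU.continuousOn hneg hinv hsm horb hopen hcpt fun x hx =>
      hU.continuousWithinAt_of_mem_frontier hpos hneg hconv hφ hφk hx
  have hlow : ∀ x ∈ closure Ω, -perron F Ω φ k x ≤ C' :=
    hC' _ hcont.neg.upperSemicontinuousOn
      (fun x hx => by rw [hUφ x hx]; linarith [(hφm x hx).1])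
      fun x hx _ => hU.isSubharmonicAt_dual hpos hopen hx
  exact ⟨_, hcont, hU.isHarmonicOn hpos hopen (hcont.mono subset_closure)
    fun x hx => by linarith [hlow x (subset_closure hx)], hUφ⟩

theorem theorem8p1p3
    {EG : Type*} [NormedAddCommGroup EG] [NormedSpace ℝ EG] [FiniteDimensional ℝ EG]
    {G : Type*} [Group G] [TopologicalSpace G] [ChartedSpace EG G] [LieGroup 𝓘(ℝ, EG) ∞ G]
    (H : Subgroup G) (hH : IsClosed (H : Set G))
    {E : Type*} [NormedAddCommGroup E] [NormedSpace ℝ E] [FiniteDimensional ℝ E]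
    [ChartedSpace E (G ⧸ H)] [IsManifold 𝓘(ℝ, E) ∞ (G ⧸ H)]
    (hsmooth : ContMDiff (𝓘(ℝ, EG).prod 𝓘(ℝ, E)) 𝓘(ℝ, E) ∞
      (fun q : G × (G ⧸ H) => q.1 • q.2))
    (g : JetDirichlet.SmoothMetric E (G ⧸ H)) (hg : JetDirichlet.IsMetricInvariant G g)
    (F : Set (JetDirichlet.Jet2 E (G ⧸ H))) (hF : JetDirichlet.IsSubequation F)
    (hinv : JetDirichlet.IsJetInvariant G F)
    (Ω : Set (G ⧸ H)) (hopen : IsOpen Ω) (hconn : IsConnected Ω)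
    (hcpt : IsCompact (closure Ω)) (hbdry : (frontier Ω).Nonempty)
    (hconv : JetDirichlet.HasStrictlyConvexBoundary F Ω)
    (hconv' : JetDirichlet.HasStrictlyConvexBoundary (JetDirichlet.dual F) Ω) :
    JetDirichlet.DirichletExistence F Ω := by
  have : IsTopologicalGroup G := topologicalGroup_of_lieGroup 𝓘(ℝ, EG) ∞
  have : ContinuousSMul G (G ⧸ H) := ⟨hsmooth.continuous⟩
  have : LocallyConnectedSpace G := ChartedSpace.locallyConnectedSpace EG G
  have : IsClosed (H : Set G) := hH
  have : IsManifold 𝓘(ℝ, E) 2 (G ⧸ H) := .of_le (n := ∞) (by decide)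
  have hsm : ∀ a : G, ContMDiff 𝓘(ℝ, E) 𝓘(ℝ, E) 2 (fun z : G ⧸ H => a • z) := fun a =>
    (hsmooth.comp (contMDiff_const.prodMk contMDiff_id)).of_le (by decide)
  exact theorem8p1p3_general hsm isOpenMap_smul_quotient hF hinv hopen hconn.isPreconnected hcpt
    hbdry hconv hconv'
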